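/- Let $q_0,q_1,q_2$ be the vertices (top, bottom left, bottom right) of an equilateral triangle in the plane, let $F_i(z)=\frac13 z+\frac23 q_i$ for $i=0,1,2$, $F_3(z)=\frac13 z+\frac13(q_1+q_2)$, $F_4(z)=\frac13 z+\frac13(q_0+q_2)$, $F_5(z)=\frac13 z+\frac13(q_0+q_1)$, and let $\mathcal{SG}_3$ be the nonempty compact set with $\mathcal{SG}_3=\bigcup_{i=0}^5F_i\mathcal{SG}_3$. Write $F_w=F_{w_1}\circ\cdots\circ F_{w_m}$ for a word $w=w_1\cdots w_m\in\{0,\dots,5\}^m$, and call $F_w\mathcal{SG}_3$ an $m$-cell. Let $V_0=\{q_0,q_1,q_2\}$, $V_m=\bigcup_iF_iV_{m-1}$, and $x\sim_m y$ if $x\ne y$ are points of $V_m$ of the form $F_wq_i$, $F_wq_j$ with a common word $w$ of length $m$. Let $$\mathcal E_m(u,v)=\left(\tfrac{15}{7}\right)^{m}\sum_{x\sim_m y}(u(x)-u(y))(v(x)-v(y))$$ (each edge counted once) and $\mathcal E(u,v)=\lim_m\mathcal E_m(u,v)$. A function $v$ has finite energy if $\mathcal E(v,v)<\infty$. A continuous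 function is harmonic on $\mathcal{SG}_3$ if for every $m$ it minimizes $\mathcal E_{m+1}$ among the functions with the same values on $V_m$. Let $h_a$ be the harmonic function with values $0,1,-1$ at $q_0,q_1,q_2$, and put $$\Omega=\{x\in\mathcal{SG}_3\setminus V_0:h_a(x)>0\},\qquad X=\{x\in\mathcal{SG}_3:h_a(x)=0\},\qquad \partial\Omega=\{q_1\}\cup X .$$ Let $\mathcal E_\Omega(u,v)$ be the limit of the parts of $\mathcal E_m(u,v)$ that come from the $m$-cells contained in $\overline\Omega$, and say $u\in\mathrm{dom}\,\mathcal E_\Omega$ if $\mathcal E_\Omega(u,u)<\infty$. **Theorem 2.1.** Let $f\in C(\partial\Omega)$ and let $u\in C(\overline\Omega)$ be a solution of the Dirichlet problem $\Delta u=0$ in $\Omega$, $u|_{\partial\Omega}=f$, where $\Delta u=0$ in $\Omega$ means that $\mathcal E_\Omega(u,v)=0$ for every $v$ of finite energy on $\mathcal{SG}_3$ that vanishes outside a compact subset of $\Omega$. For a finite word $w\in\{0,3\}^*$ let $p_w=F_wF_3q_0$ and $\mu_w=\mu_{w_1}\cdots\mu_{w_{|w|}}$, with $\mu_0=\frac17$,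 $\mu_3=\frac47$, $\mu_\emptyset=1$. Then the normal derivative $$\partial_nu(q_1)=\lim_{m\to\infty}\left(\tfrac{15}{7}\right)^m\bigl(2u(q_1)-u(F_1^mq_2)-u(F_1^mq_0)\bigr)$$ exists, the series below converges absolutely, and $$\partial_nu(q_1)=3f(q_1)-\sum_{w\in\{0,3\}^*}\tfrac67\,\mu_w f(p_w).$$ Moreover $\mu=\sum_{w\in\{0,3\}^*}\frac27\mu_w\delta_{p_w}$ is a probability measure carried by $X$, $f|_X$ is $\mu$-integrable, and $$\partial_nu(q_1)=3f(q_1)-3\int_Xf\,d\mu .$$ If in addition $u\in\mathrm{dom}\,\mathcal E_\Omega$, then $\mathcal E_\Omega(h_a,u)$ exists and $$\mathcal E_\Omega(h_a,u)=\partial_nu(q_1).$$ -/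

import Mathlib

open Filter Topology MeasureTheory

namespace HalfSG3

/-- The Euclidean plane. -/
abbrev Plane := EuclideanSpace ℝ (Fin 2)

/-- The boundary vertices `q₀` (top), `q₁` (bottom left), `q₂` (bottom right) of an equilateral
triangle of side one. -/
noncomputable def q : Fin 3 → Plane :=
  ![!₂[1 / 2, √3 / 2], !₂[0, 0], !₂[1, 0]]

/-- The translation parts of the six contractions:
`(2/3) q₀, (2/3) q₁, (2/3) q₂, (1/3)(q₁ + q₂), (1/3)(q₀ + q₂), (1/3)(q₀ + q₁)`. -/
noncomputable def shift : Fin 6 → Plane :=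
  ![(2 / 3 : ℝ) • q 0, (2 / 3 : ℝ) • q 1, (2 / 3 : ℝ) • q 2,
    (1 / 3 : ℝ) • (q 1 + q 2), (1 / 3 : ℝ) • (q 0 + q 2), (1 / 3 : ℝ) • (q 0 + q 1)]

/-- The six contractions `F₀, …, F₅` of the level-3 Sierpinski gasket. -/
noncomputable def F (i : Fin 6) (z : Plane) : Plane := (1 / 3 : ℝ) • z + shift i

/-- `F_w = F_{w₁} ∘ ⋯ ∘ F_{w_m}` for a word `w = w₁ ⋯ w_m`. -/
noncomputable def Fw : List (Fin 6) → Plane → Plane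
  | [] => id
  | i :: w => F i ∘ Fw w

/-- The vertex sets `V_m`. -/
def V : ℕ → Set Plane
  | 0 => Set.range q
  | m + 1 => ⋃ i : Fin 6, F i '' V m

/-- The set of all vertices `V_*`. -/
def Vstar : Set Plane := ⋃ m, V m

/-- The level-3 Sierpinski gasket, realised as the closure of `V_*`. The facts `SG_nonempty`,
`SG_isCompact`, `SG_eq_iUnion`, `SG_unique` below say that it is the unique nonempty compact set
`K` with `K = ⋃ i, F i '' K`. -/
def SG : Set Plane := closure Vstar

/-- The bilinear form of the triangle graph. -/
def triForm (a b : Fin 3 → ℝ) : ℝ :=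
  (a 0 - a 1) * (b 0 - b 1) + (a 1 - a 2) * (b 1 - b 2) + (a 2 - a 0) * (b 2 - b 0)

/-- The contribution to the graph energy of the three edges of the cell `F_w SG`, without the
renormalization factor. -/
noncomputable def cellForm (u v : Plane → ℝ) (w : List (Fin 6)) : ℝ :=
  triForm (fun j => u (Fw w (q j))) (fun j => v (Fw w (q j)))

/-- The discrete resistance form `r^{-m} ∑_{x ∼_m y} (u x - u y) (v x - v y)`, `r = 7/15`, on the
`m`-th graph. Every edge is counted once; it lies in exactly one `m`-cell, so the sum over the
edges is written as a sum over the cells. -/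
noncomputable def energy (m : ℕ) (u v : Plane → ℝ) : ℝ :=
  (15 / 7 : ℝ) ^ m * ∑ w : Fin m → Fin 6, cellForm u v (List.ofFn w)

/-- `u` has finite energy on the gasket. As the graph energies increase with `m`, their limit is
finite iff they are bounded. Only the values of `u` on `V_*` matter. -/
def FiniteEnergy (u : Plane → ℝ) : Prop :=
  BddAbove (Set.range fun m => energy m u u)

/-- `h` is a harmonic function on the gasket: it is continuous, and for every `m` it minimizes the
energy of level `m + 1` among all functions with the same values on `V_m`. -/
def IsHarmonic (h : Plane → ℝ) : Prop :=
  ContinuousOn h SG ∧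
    ∀ (m : ℕ) (v : Plane → ℝ), (∀ x ∈ V m, v x = h x) →
      energy (m + 1) h h ≤ energy (m + 1) v v

/-! ### Basic facts on the gasket -/

/-- Barycentric coordinates with respect to `q₀, q₁, q₂`. -/
noncomputable def bary (x : Plane) : Fin 3 → ℝ :=
  ![2 / √3 * x 1, 1 - x 0 - x 1 / √3, x 0 - x 1 / √3]

/-- The barycentric coordinates of `3 • shift i`. -/
def sh : Fin 6 → Fin 3 → ℝ :=
  ![![2, 0, 0], ![0, 2, 0], ![0, 0, 2], ![0, 1, 1], ![1, 0, 1], ![1, 1, 0]]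

lemma bary_F (i : Fin 6) (x : Plane) (k : Fin 3) :
    bary (F i x) k = (bary x k + sh i k) / 3 := by
  have h3 : √3 ≠ 0 := by positivity
  fin_cases i <;> fin_cases k <;>
    simp [bary, F, shift, q, sh] <;> field_simp <;> ring

lemma bary_q (i k : Fin 3) : bary (q i) k = if k = i then 1 else 0 := by
  have h3 : √3 ≠ 0 := by positivity
  fin_cases i <;> fin_cases k <;> simp [bary, q] <;> field_simp <;> norm_num

lemma bary_inj {x y : Plane} (h : ∀ k, bary x k = bary y k) : x = y := by
  have h3 : √3 ≠ 0 := by positivity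
  have h0 := h 0
  have h2 := h 2
  simp only [bary, Matrix.cons_val] at h0 h2
  have e1 : x 1 = y 1 := by
    have : (2 / √3) ≠ 0 := by positivity
    exact mul_left_cancel₀ this h0
  ext k
  fin_cases k
  · simp only [e1] at h2
    simpa using h2
  · exact e1

lemma bary_sum (x : Plane) : bary x 0 + bary x 1 + bary x 2 = 1 := by
  simp only [bary, Matrix.cons_val]
  ring

lemma continuous_bary (k : Fin 3) : Continuous fun x => bary x k := by
  fin_cases k <;> simp only [bary] <;> fun_prop

lemma continuous_F (i : Fin 6) : Continuous (F i) := by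
  unfold F
  fun_prop

/-- The inverse of `F i`. -/
noncomputable def Finv (i : Fin 6) (y : Plane) : Plane := (3 : ℝ) • (y - shift i)

lemma Finv_F (i : Fin 6) (x : Plane) : Finv i (F i x) = x := by
  simp [Finv, F, smul_smul]

lemma F_Finv (i : Fin 6) (x : Plane) : F i (Finv i x) = x := by
  simp [Finv, F, smul_smul]

lemma continuous_Finv (i : Fin 6) : Continuous (Finv i) := by
  unfold Finv; fun_prop

lemma q_mem_SG (i : Fin 3) : q i ∈ SG :=
  subset_closure (Set.mem_iUnion.2 ⟨0, ⟨i, rfl⟩⟩)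

lemma SG_nonempty : SG.Nonempty := ⟨_, q_mem_SG 0⟩

lemma V_subset_SG (m : ℕ) : V m ⊆ SG := fun _ hx =>
  subset_closure (Set.mem_iUnion.2 ⟨m, hx⟩)

lemma F_mem_SG (i : Fin 6) {x : Plane} (hx : x ∈ SG) : F i x ∈ SG := by
  refine map_mem_closure (continuous_F i) hx ?_
  intro y hy
  obtain ⟨m, hm⟩ := Set.mem_iUnion.1 hy
  exact Set.mem_iUnion.2 ⟨m + 1, Set.mem_iUnion.2 ⟨i, y, hm, rfl⟩⟩

/-- The three maps that fix a boundary vertex. -/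
def corner (i : Fin 3) : Fin 6 := Fin.castLE (by norm_num) i

lemma F_corner (i : Fin 3) : F (corner i) (q i) = q i := by
  apply bary_inj
  intro k
  rw [bary_F, bary_q]
  fin_cases i <;> fin_cases k <;> simp [corner, sh] <;> norm_num

lemma image_eq_preimage (i : Fin 6) (s : Set Plane) : F i '' s = Finv i ⁻¹' s := by
  ext y
  constructor
  · rintro ⟨x, hx, rfl⟩
    simpa [Finv_F] using hx
  · intro hy
    exact ⟨_, hy, F_Finv i y⟩

lemma isClosed_image (i : Fin 6) : IsClosed (F i '' SG) := by
  rw [image_eq_preimage]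
  exact isClosed_closure.preimage (continuous_Finv i)

lemma SG_eq_iUnion : SG = ⋃ i : Fin 6, F i '' SG := by
  apply Set.Subset.antisymm
  · apply closure_minimal
    · intro x hx
      obtain ⟨m, hm⟩ := Set.mem_iUnion.1 hx
      cases m with
      | zero =>
        obtain ⟨i, rfl⟩ := hm
        exact Set.mem_iUnion.2 ⟨corner i, q i, q_mem_SG i, F_corner i⟩
      | succ m =>
        obtain ⟨i, y, hy, rfl⟩ := Set.mem_iUnion.1 hm
        exact Set.mem_iUnion.2 ⟨i, y, V_subset_SG m hy, rfl⟩
    · exact isClosed_iUnion_of_finite isClosed_image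
  · exact Set.iUnion_subset fun i => by
      rintro _ ⟨x, hx, rfl⟩
      exact F_mem_SG i hx

lemma bary_nonneg {x : Plane} (hx : x ∈ SG) (k : Fin 3) : 0 ≤ bary x k := by
  have key : ∀ m, ∀ x ∈ V m, ∀ k, 0 ≤ bary x k := by
    intro m
    induction m with
    | zero =>
      rintro _ ⟨i, rfl⟩ k
      rw [bary_q]; split_ifs <;> norm_num
    | succ m ih =>
      intro x hx k
      obtain ⟨i, y, hy, rfl⟩ := Set.mem_iUnion.1 hx
      rw [bary_F]
      have h1 := ih y hy k
      have h2 : 0 ≤ sh i k := by fin_cases i <;> fin_cases k <;> simp [sh]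
      positivity
  have hc : IsClosed {x : Plane | 0 ≤ bary x k} :=
    isClosed_le continuous_const (continuous_bary k)
  refine closure_minimal ?_ hc hx
  intro y hy
  obtain ⟨m, hm⟩ := Set.mem_iUnion.1 hy
  exact key m y hm k

lemma SG_isCompact : IsCompact SG := by
  refine Metric.isCompact_of_isClosed_isBounded isClosed_closure ?_
  refine isBounded_iff_forall_norm_le.2 ⟨2, fun x hx => ?_⟩
  have h0 := bary_nonneg hx 0
  have h1 := bary_nonneg hx 1
  have h2 := bary_nonneg hx 2
  have hs : 0 < √3 := by positivity
  have hs3 : √3 ^ 2 = 3 := Real.sq_sqrt (by norm_num)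
  simp only [bary, Matrix.cons_val] at h0 h1 h2
  set t := x 1 / √3 with ht
  have hx1 : x 1 = t * √3 := by rw [ht]; field_simp
  have e0 : 0 ≤ t := by
    have : 2 / √3 * x 1 = 2 * t := by rw [ht]; ring
    linarith
  rw [EuclideanSpace.norm_eq, Real.sqrt_le_left (by norm_num), Fin.sum_univ_two]
  simp only [Real.norm_eq_abs, sq_abs]
  rw [hx1, mul_pow, hs3]
  nlinarith

lemma eq_of_bary_one {x : Plane} (hx : x ∈ SG) (a : Fin 3) (h : 1 ≤ bary x a) : x = q a := by
  have h0 := bary_nonneg hx 0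
  have h1 := bary_nonneg hx 1
  have h2 := bary_nonneg hx 2
  have hs := bary_sum x
  apply bary_inj
  intro k
  rw [bary_q]
  fin_cases a <;> fin_cases k <;> simp at h ⊢ <;> linarith

lemma SG_unique (K : Set Plane) (hne : K.Nonempty) (hK : IsCompact K)
    (h : K = ⋃ i : Fin 6, F i '' K) : K = SG := by
  have dF : ∀ i x y, dist (F i x) (F i y) = (1 / 3) * dist x y := by
    intro i x y
    simp [F, dist_smul₀]
  have main : ∀ A B : Set Plane, B.Nonempty → IsCompact A → IsCompact B →
      A = (⋃ i : Fin 6, F i '' A) → B = (⋃ i : Fin 6, F i '' B) → A ⊆ B := by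
    intro A B hBne hA hB hAeq hBeq
    obtain ⟨C, hC⟩ := (Metric.isBounded_iff.1 (hA.union hB).isBounded)
    have key : ∀ n : ℕ, ∀ x ∈ A, ∃ y ∈ B, dist x y ≤ (1 / 3) ^ n * C := by
      intro n
      induction n with
      | zero =>
        intro x hx
        obtain ⟨y, hy⟩ := hBne
        exact ⟨y, hy, by simpa using hC (Or.inl hx) (Or.inr hy)⟩
      | succ n ih =>
        intro x hx
        rw [hAeq] at hx
        obtain ⟨i, x', hx', rfl⟩ := Set.mem_iUnion.1 hx
        obtain ⟨y, hy, hd⟩ := ih x' hx'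
        refine ⟨F i y, ?_, ?_⟩
        · rw [hBeq]; exact Set.mem_iUnion.2 ⟨i, y, hy, rfl⟩
        · rw [dF, pow_succ]; linarith
    intro x hx
    rw [← hB.isClosed.closure_eq, Metric.mem_closure_iff]
    intro ε hε
    have ht : Tendsto (fun n : ℕ => ((1 : ℝ) / 3) ^ n * C) atTop (𝓝 (0 * C)) :=
      (tendsto_pow_atTop_nhds_zero_of_lt_one (by norm_num) (by norm_num)).mul_const C
    rw [zero_mul] at ht
    obtain ⟨n, hn⟩ := (ht.eventually (gt_mem_nhds hε)).exists
    obtain ⟨y, hy, hd⟩ := key n x hx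
    exact ⟨y, hy, lt_of_le_of_lt hd hn⟩
  exact Set.Subset.antisymm
    (main K SG SG_nonempty hK SG_isCompact h SG_eq_iUnion)
    (main SG K hne SG_isCompact hK SG_eq_iUnion h)

/-! ### Existence of harmonic functions with prescribed values on `V_0` -/

/-- The harmonic extension algorithm: from the values `b` of a harmonic function at
`q₀, q₁, q₂` to its values at `F_i q₀, F_i q₁, F_i q₂`. -/
noncomputable def ext (b : Fin 3 → ℝ) : Fin 6 → Fin 3 → ℝ :=
  ![![b 0, (8 * b 0 + 4 * b 1 + 3 * b 2) / 15, (8 * b 0 + 3 * b 1 + 4 * b 2) / 15],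
    ![(4 * b 0 + 8 * b 1 + 3 * b 2) / 15, b 1, (3 * b 0 + 8 * b 1 + 4 * b 2) / 15],
    ![(4 * b 0 + 3 * b 1 + 8 * b 2) / 15, (3 * b 0 + 4 * b 1 + 8 * b 2) / 15, b 2],
    ![(b 0 + b 1 + b 2) / 3, (3 * b 0 + 8 * b 1 + 4 * b 2) / 15,
      (3 * b 0 + 4 * b 1 + 8 * b 2) / 15],
    ![(8 * b 0 + 3 * b 1 + 4 * b 2) / 15, (b 0 + b 1 + b 2) / 3,
      (4 * b 0 + 3 * b 1 + 8 * b 2) / 15],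
    ![(8 * b 0 + 4 * b 1 + 3 * b 2) / 15, (4 * b 0 + 8 * b 1 + 3 * b 2) / 15,
      (b 0 + b 1 + b 2) / 3]]

lemma ext_corner (b : Fin 3 → ℝ) (i : Fin 3) : ext b (corner i) i = b i := by
  fin_cases i <;> rfl

/-- Distinct cells meet only at common vertices, where the extension algorithm is consistent. -/
lemma overlap (b : Fin 3 → ℝ) {i j : Fin 6} (hij : i ≠ j) {x y : Plane} (hx : x ∈ SG)
    (hy : y ∈ SG) (h : F i x = F j y) :
    ∃ a c, x = q a ∧ y = q c ∧ ext b i a = ext b j c := by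
  have x0 := bary_nonneg hx 0
  have x1 := bary_nonneg hx 1
  have x2 := bary_nonneg hx 2
  have y0 := bary_nonneg hy 0
  have y1 := bary_nonneg hy 1
  have y2 := bary_nonneg hy 2
  have sx := bary_sum x
  have sy := bary_sum y
  have hk : ∀ k, bary x k + sh i k = bary y k + sh j k := by
    intro k
    have := congrArg (fun z => bary z k) h
    simp only [bary_F] at this
    linarith
  have k0 := hk 0
  have k1 := hk 1
  have k2 := hk 2
  have fin : ∀ a c, 1 ≤ bary x a → 1 ≤ bary y c → ext b i a = ext b j c →
      ∃ a c, x = q a ∧ y = q c ∧ ext b i a = ext b j c := fun a c ha hc he =>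
    ⟨a, c, eq_of_bary_one hx a ha, eq_of_bary_one hy c hc, he⟩
  fin_cases i <;> fin_cases j <;> simp [sh] at k0 k1 k2 hij <;>
    first
    | (exfalso; linarith)
    | exact fin 0 1 (by linarith) (by linarith) rfl
    | exact fin 0 2 (by linarith) (by linarith) rfl
    | exact fin 1 0 (by linarith) (by linarith) rfl
    | exact fin 1 2 (by linarith) (by linarith) rfl
    | exact fin 2 0 (by linarith) (by linarith) rfl
    | exact fin 2 1 (by linarith) (by linarith) rfl

open Classical in
/-- Approximations of the harmonic function with boundary values `b`: apply the extension
algorithm `n` times and interpolate linearly. -/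
noncomputable def approx : ℕ → (Fin 3 → ℝ) → Plane → ℝ
  | 0, b, x => b 0 * bary x 0 + b 1 * bary x 1 + b 2 * bary x 2
  | n + 1, b, x =>
    if h : ∃ i, Finv i x ∈ SG then approx n (ext b h.choose) (Finv h.choose x) else 0

lemma approx_spec (n : ℕ) : (∀ b i, approx n b (q i) = b i) ∧
    (∀ b i, ∀ x ∈ SG, approx (n + 1) b (F i x) = approx n (ext b i) x) := by
  have step : ∀ n, (∀ b i, approx n b (q i) = b i) →
      (∀ b i, ∀ x ∈ SG, approx (n + 1) b (F i x) = approx n (ext b i) x) := by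
    intro n hn b i x hx
    have hex : ∃ j, Finv j (F i x) ∈ SG := ⟨i, by rwa [Finv_F]⟩
    rw [approx, dif_pos hex]
    have hc := hex.choose_spec
    generalize hex.choose = j at hc
    by_cases hij : j = i
    · subst hij; rw [Finv_F]
    · obtain ⟨a, c, h1, h2, h3⟩ := overlap b hij hc hx (F_Finv j (F i x))
      rw [h1, h2, hn, hn, h3]
  have hq : ∀ b i, approx n b (q i) = b i := by
    induction n with
    | zero =>
      intro b i
      simp only [approx, bary_q]
      fin_cases i <;> simp
    | succ n ih =>
      intro b i
      have := step n ih b (corner i) (q i) (q_mem_SG i)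
      rw [F_corner] at this
      rw [this, ih, ext_corner]
  exact ⟨hq, step n hq⟩

lemma approx_continuousOn (n : ℕ) : ∀ b, ContinuousOn (approx n b) SG := by
  induction n with
  | zero =>
    intro b
    have := continuous_bary
    apply Continuous.continuousOn
    simp only [approx]
    exact (((this 0).const_mul _).add ((this 1).const_mul _)).add ((this 2).const_mul _)
  | succ n ih =>
    intro b
    rw [SG_eq_iUnion]
    apply (locallyFinite_of_finite _).continuousOn_iUnion isClosed_image
    intro i
    have h1 : ContinuousOn (fun y => approx n (ext b i) (Finv i y)) (F i '' SG) := by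
      refine (ih (ext b i)).comp (continuous_Finv i).continuousOn ?_
      rintro _ ⟨x, hx, rfl⟩
      rwa [Finv_F]
    refine h1.congr ?_
    rintro _ ⟨x, hx, rfl⟩
    simp only [Finv_F]
    exact (approx_spec n).2 b i x hx

lemma approx_dist (n : ℕ) : ∀ (b : Fin 3 → ℝ) (M : ℝ), (∀ i j, b i - b j ≤ M) →
    ∀ x ∈ SG, dist (approx n b x) (approx (n + 1) b x) ≤ M * (1 / 2) ^ n := by
  induction n with
  | zero =>
    intro b M hM y hyS
    rw [SG_eq_iUnion] at hyS
    obtain ⟨i, x, hx, rfl⟩ := Set.mem_iUnion.1 hyS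
    rw [(approx_spec 0).2 b i x hx]
    have x0 := bary_nonneg hx 0
    have x1 := bary_nonneg hx 1
    have x2 := bary_nonneg hx 2
    have sx := bary_sum x
    have hy := F_mem_SG i hx
    have y0 := bary_nonneg hy 0
    have y1 := bary_nonneg hy 1
    have y2 := bary_nonneg hy 2
    have sy := bary_sum (F i x)
    obtain ⟨m, hm⟩ : ∃ m, ∀ k, m ≤ b k ∧ b k ≤ m + M := by
      obtain ⟨k0, hk0⟩ := Finite.exists_min b
      exact ⟨b k0, fun k => ⟨hk0 k, by linarith [hM k k0]⟩⟩
    have conv : ∀ (c : Fin 3 → ℝ) (z : Plane), z ∈ SG → (∀ k, m ≤ c k ∧ c k ≤ m + M) →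
        m ≤ approx 0 c z ∧ approx 0 c z ≤ m + M := by
      intro c z hz hc
      have z0 := bary_nonneg hz 0
      have z1 := bary_nonneg hz 1
      have z2 := bary_nonneg hz 2
      have sz := bary_sum z
      simp only [approx]
      have e2 : bary z 2 = 1 - bary z 0 - bary z 1 := by linarith
      constructor
      · have a0 := mul_nonneg (sub_nonneg.2 (hc 0).1) z0
        have a1 := mul_nonneg (sub_nonneg.2 (hc 1).1) z1
        have a2 := mul_nonneg (sub_nonneg.2 (hc 2).1) z2
        rw [e2] at a2 ⊢
        linarith
      · have a0 := mul_nonneg (sub_nonneg.2 (hc 0).2) z0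
        have a1 := mul_nonneg (sub_nonneg.2 (hc 1).2) z1
        have a2 := mul_nonneg (sub_nonneg.2 (hc 2).2) z2
        rw [e2] at a2 ⊢
        linarith
    have hext : ∀ k, m ≤ ext b i k ∧ ext b i k ≤ m + M := by
      have m0 := hm 0
      have m1 := hm 1
      have m2 := hm 2
      intro k
      fin_cases i <;> fin_cases k <;> simp [ext] <;> constructor <;> linarith
    have c1 := conv b _ hy hm
    have c2 := conv (ext b i) _ hx hext
    rw [Real.dist_eq, abs_le]
    constructor <;> simp <;> linarith
  | succ n ih =>
    intro b M hM y hyS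
    rw [SG_eq_iUnion] at hyS
    obtain ⟨i, x, hx, rfl⟩ := Set.mem_iUnion.1 hyS
    rw [(approx_spec n).2 b i x hx, (approx_spec (n + 1)).2 b i x hx]
    have := ih (ext b i) (M / 2) (by
      have h00 := hM 0 0
      have h01 := hM 0 1
      have h02 := hM 0 2
      have h10 := hM 1 0
      have h12 := hM 1 2
      have h20 := hM 2 0
      have h21 := hM 2 1
      intro j k
      fin_cases i <;> fin_cases j <;> fin_cases k <;> simp [ext] <;> linarith) x hx
    refine this.trans (le_of_eq ?_)
    rw [pow_succ]; ring

/-- Continuous functions that follow the extension algorithm. -/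
lemma exists_ext : ∃ h : (Fin 3 → ℝ) → Plane → ℝ, (∀ b, ContinuousOn (h b) SG) ∧
    (∀ b i, h b (q i) = b i) ∧ ∀ b i, ∀ x ∈ SG, h b (F i x) = h (ext b i) x := by
  have hM : ∀ b : Fin 3 → ℝ, ∃ M : ℝ, ∀ i j, b i - b j ≤ M := by
    intro b
    obtain ⟨i, hi⟩ := Finite.exists_max b
    obtain ⟨j, hj⟩ := Finite.exists_min b
    exact ⟨b i - b j, fun k l => by linarith [hi k, hj l]⟩
  have hlim : ∀ b x, ∃ y, x ∈ SG → Tendsto (fun n => approx n b x) atTop (𝓝 y) := by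
    intro b x
    by_cases hx : x ∈ SG
    · obtain ⟨M, hM⟩ := hM b
      have hc : CauchySeq fun n => approx n b x :=
        cauchySeq_of_le_geometric (1 / 2) M (by norm_num) fun n => approx_dist n b M hM x hx
      obtain ⟨y, hy⟩ := cauchySeq_tendsto_of_complete hc
      exact ⟨y, fun _ => hy⟩
    · exact ⟨0, fun h => absurd h hx⟩
  choose h hh using hlim
  refine ⟨h, ?_, ?_, ?_⟩
  · intro b
    obtain ⟨M, hM⟩ := hM b
    have hu : TendstoUniformlyOn (fun n => approx n b) (h b) atTop SG := by
      rw [Metric.tendstoUniformlyOn_iff]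
      intro ε hε
      have ht : Tendsto (fun n : ℕ => M * (1 / 2 : ℝ) ^ n / (1 - 1 / 2)) atTop
          (𝓝 (M * 0 / (1 - 1 / 2))) :=
        ((tendsto_pow_atTop_nhds_zero_of_lt_one (by norm_num) (by norm_num)).const_mul
          M).div_const _
      simp only [mul_zero, zero_div] at ht
      filter_upwards [ht.eventually (gt_mem_nhds hε)] with n hn x hx
      rw [dist_comm]
      exact lt_of_le_of_lt (dist_le_of_le_geometric_of_tendsto (1 / 2) M (by norm_num)
        (fun n => approx_dist n b M hM x hx) (hh b x hx) n) hn
    exact hu.continuousOn (Frequently.of_forall fun n => approx_continuousOn n b)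
  · intro b i
    refine tendsto_nhds_unique (hh b (q i) (q_mem_SG i)) ?_
    simp only [(approx_spec _).1]
    exact tendsto_const_nhds
  · intro b i x hx
    refine tendsto_nhds_unique ((tendsto_add_atTop_iff_nat 1).2
      (hh b (F i x) (F_mem_SG i hx))) ?_
    simp only [(approx_spec _).2 b i x hx]
    exact hh (ext b i) x hx

lemma energy_succ (m : ℕ) (u v : Plane → ℝ) :
    energy (m + 1) u v = (15 / 7 : ℝ) * ∑ i, energy m (u ∘ F i) (v ∘ F i) := by
  simp only [energy]
  rw [← Finset.mul_sum, ← mul_assoc, ← pow_succ', ← (Fin.consEquiv fun _ => Fin 6).sum_comp,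
    Fintype.sum_prod_type]
  simp [Fin.consEquiv, List.ofFn_succ, cellForm, Fw, Fin.cons_zero, Fin.cons_succ]

lemma energy_congr (m : ℕ) {u u' : Plane → ℝ} (h : ∀ x ∈ SG, u x = u' x) :
    energy m u u = energy m u' u' := by
  have hw : ∀ (w : List (Fin 6)) j, Fw w (q j) ∈ SG := by
    intro w j
    induction w with
    | nil => exact q_mem_SG j
    | cons i w ih => exact F_mem_SG i ih
  simp only [energy, cellForm, h _ (hw _ _)]

lemma F_q_glue :
    F 0 (q 1) = F 5 (q 0) ∧ F 0 (q 2) = F 4 (q 0) ∧ F 1 (q 0) = F 5 (q 1) ∧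
    F 1 (q 2) = F 3 (q 1) ∧ F 2 (q 0) = F 4 (q 2) ∧ F 2 (q 1) = F 3 (q 2) ∧
    F 3 (q 0) = F 5 (q 2) ∧ F 4 (q 1) = F 5 (q 2) := by
  refine ⟨?_, ?_, ?_, ?_, ?_, ?_, ?_, ?_⟩ <;>
  · apply bary_inj
    intro k
    simp only [bary_F, bary_q]
    fin_cases k <;> simp [sh] <;> norm_num

theorem exists_isHarmonic (b : Fin 3 → ℝ) :
    ∃ h : Plane → ℝ, IsHarmonic h ∧ ∀ i, h (q i) = b i := by
  obtain ⟨h, hc, hq, hF⟩ := exists_ext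
  refine ⟨h b, ⟨hc b, ?_⟩, hq b⟩
  intro m
  induction m generalizing b with
  | zero =>
    intro v hv
    have v0 : v (F 0 (q 0)) = b 0 := by
      have := F_corner 0
      simp only [corner, Fin.castLE_zero] at this
      rw [this, hv _ ⟨0, rfl⟩, hq]
    have v1 : v (F 1 (q 1)) = b 1 := by
      have : F 1 (q 1) = q 1 := F_corner 1
      rw [this, hv _ ⟨1, rfl⟩, hq]
    have v2 : v (F 2 (q 2)) = b 2 := by
      have : F 2 (q 2) = q 2 := F_corner 2
      rw [this, hv _ ⟨2, rfl⟩, hq]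
    obtain ⟨g1, g2, g3, g4, g5, g6, g7, g8⟩ := F_q_glue
    rw [energy_succ, energy_succ]
    simp only [energy, pow_zero, one_mul, Fintype.sum_unique, List.ofFn_zero, cellForm, Fw, id,
      triForm, Fin.sum_univ_six, Function.comp, hF _ _ _ (q_mem_SG _), hq,
      v0, v1, v2, g1, g2, g3, g4, g5, g6, g7, g8]
    generalize v (F 5 (q 0)) = a1
    generalize v (F 4 (q 0)) = a2
    generalize v (F 5 (q 1)) = a3
    generalize v (F 3 (q 1)) = a4
    generalize v (F 4 (q 2)) = a5
    generalize v (F 3 (q 2)) = a6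
    generalize v (F 5 (q 2)) = a7
    simp only [ext, Matrix.cons_val]
    obtain ⟨d1, h1⟩ : ∃ d, a1 = (8 * b 0 + 4 * b 1 + 3 * b 2) / 15 + d := ⟨_, (add_sub_cancel _ _).symm⟩
    obtain ⟨d2, h2⟩ : ∃ d, a2 = (8 * b 0 + 3 * b 1 + 4 * b 2) / 15 + d := ⟨_, (add_sub_cancel _ _).symm⟩
    obtain ⟨d3, h3⟩ : ∃ d, a3 = (4 * b 0 + 8 * b 1 + 3 * b 2) / 15 + d := ⟨_, (add_sub_cancel _ _).symm⟩
    obtain ⟨d4, h4⟩ : ∃ d, a4 = (3 * b 0 + 8 * b 1 + 4 * b 2) / 15 + d := ⟨_, (add_sub_cancel _ _).symm⟩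
    obtain ⟨d5, h5⟩ : ∃ d, a5 = (4 * b 0 + 3 * b 1 + 8 * b 2) / 15 + d := ⟨_, (add_sub_cancel _ _).symm⟩
    obtain ⟨d6, h6⟩ : ∃ d, a6 = (3 * b 0 + 4 * b 1 + 8 * b 2) / 15 + d := ⟨_, (add_sub_cancel _ _).symm⟩
    obtain ⟨d7, h7⟩ : ∃ d, a7 = (b 0 + b 1 + b 2) / 3 + d := ⟨_, (add_sub_cancel _ _).symm⟩
    subst h1 h2 h3 h4 h5 h6 h7
    have pos : 0 ≤ (d1 ^ 2 + d2 ^ 2 + (d1 - d2) ^ 2) + (d3 ^ 2 + d4 ^ 2 + (d3 - d4) ^ 2) +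
        (d5 ^ 2 + d6 ^ 2 + (d5 - d6) ^ 2) +
        ((d7 - d4) ^ 2 + (d4 - d6) ^ 2 + (d6 - d7) ^ 2) +
        ((d2 - d7) ^ 2 + (d7 - d5) ^ 2 + (d5 - d2) ^ 2) +
        ((d1 - d3) ^ 2 + (d3 - d7) ^ 2 + (d7 - d1) ^ 2) := by positivity
    rw [← sub_nonneg]
    refine le_of_le_of_eq (mul_nonneg (by norm_num : (0 : ℝ) ≤ 15 / 7) pos) ?_
    ring
  | succ m ih =>
    intro v hv
    rw [energy_succ, energy_succ]
    gcongr with i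
    have e : energy (m + 1) (h b ∘ F i) (h b ∘ F i) =
        energy (m + 1) (h (ext b i)) (h (ext b i)) :=
      energy_congr _ fun x hx => hF b i x hx
    rw [e]
    apply ih
    intro x hx
    rw [← hF b i x (V_subset_SG m hx)]
    exact hv _ (Set.mem_iUnion.2 ⟨i, x, hx, rfl⟩)

/-- The harmonic function with values `b 0, b 1, b 2` at `q₀, q₁, q₂`. -/
noncomputable def harmonicExt (b : Fin 3 → ℝ) : Plane → ℝ := (exists_isHarmonic b).choose

lemma harmonicExt_spec (b : Fin 3 → ℝ) :
    IsHarmonic (harmonicExt b) ∧ ∀ i, harmonicExt b (q i) = b i :=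
  (exists_isHarmonic b).choose_spec

/-- The antisymmetric harmonic function `h_a`, with values `0, 1, -1` at `q₀, q₁, q₂`. -/
noncomputable def ha : Plane → ℝ := harmonicExt ![0, 1, -1]

/-! ### The half domain -/

/-- The left half domain. -/
def Omega : Set Plane := {x | x ∈ SG ∧ x ∉ V 0 ∧ 0 < ha x}

/-- The Cantor set part of the boundary. -/
def X : Set Plane := {x | x ∈ SG ∧ ha x = 0}

/-- The boundary of the half domain. -/
def bdOmega : Set Plane := {q 1} ∪ X

open Classical in
/-- The part of the discrete resistance form of level `m` carried by the `m`-cells that are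
contained in the closure of the half domain. -/
noncomputable def energyOmega (m : ℕ) (u v : Plane → ℝ) : ℝ :=
  (15 / 7 : ℝ) ^ m *
    ∑ w : Fin m → Fin 6 with Fw (List.ofFn w) '' SG ⊆ closure Omega, cellForm u v (List.ofFn w)

/-- `𝓔_Ω(u, v)` exists as the limit of the discrete forms, and is equal to `c`. -/
def HasEnergyOmega (u v : Plane → ℝ) (c : ℝ) : Prop :=
  Tendsto (fun m => energyOmega m u v) atTop (𝓝 c)

/-- `u ∈ dom 𝓔_Ω`. The numbers `energyOmega m u u` increase with `m`, so their limit is finite iff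
they are bounded. -/
def FiniteEnergyOmega (u : Plane → ℝ) : Prop :=
  BddAbove (Set.range fun m => energyOmega m u u)

/-- `Δ u = 0` in `Ω`, in the weak sense: `𝓔(u, v) = 0` for every function `v` of finite energy that
vanishes outside a compact subset of `Ω`. For such `v`, only cells contained in the closure of `Ω`
contribute to the discrete energies of high levels. -/
def LaplacianZeroInOmega (u : Plane → ℝ) : Prop :=
  ∀ v : Plane → ℝ, FiniteEnergy v →
    (∃ C : Set Plane, IsCompact C ∧ C ⊆ Omega ∧ ∀ x ∈ SG, x ∉ C → v x = 0) →
    HasEnergyOmega u v 0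

/-- `u` is a solution of the Dirichlet problem `Δ u = 0` in `Ω`, `u = f` on the boundary. -/
structure IsDirichletSolution (f u : Plane → ℝ) : Prop where
  continuousOn : ContinuousOn u (closure Omega)
  harmonic : LaplacianZeroInOmega u
  boundary : ∀ x ∈ bdOmega, u x = f x

/-- The normal derivative of `u` at the boundary vertex `q i` exists and is equal to `d`
(indices modulo 3). -/
def HasNormalDeriv (u : Plane → ℝ) (i : Fin 3) (d : ℝ) : Prop :=
  Tendsto (fun m : ℕ => (15 / 7 : ℝ) ^ m *
    (2 * u (q i) - u ((F (corner i))^[m] (q (i + 1))) - u ((F (corner i))^[m] (q (i - 1)))))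
    atTop (𝓝 d)

/-- Finite words in the alphabet `{0, 3}`. -/
abbrev HalfWord := List {i : Fin 6 // i = 0 ∨ i = 3}

/-- `p_w = F_w F_3 q₀`. -/
noncomputable def p (w : HalfWord) : Plane := Fw (w.map Subtype.val) (F 3 (q 0))

/-- `μ_w`, the product of the factors `μ_0 = 1/7` and `μ_3 = 4/7`. -/
noncomputable def muWord (w : HalfWord) : ℝ :=
  (w.map fun i => if i.1 = 0 then (1 / 7 : ℝ) else 4 / 7).prod

/-- The measure `μ = ∑_w (2/7) μ_w δ_{p_w}`. -/
noncomputable def mu : Measure Plane :=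
  Measure.sum fun w : HalfWord => ENNReal.ofReal (2 / 7 * muWord w) • Measure.dirac (p w)

end HalfSG3

namespace HalfSG3

/-! ### Words and vertices -/

lemma Fw_append (w v : List (Fin 6)) (x : Plane) : Fw (w ++ v) x = Fw w (Fw v x) := by
  induction w with
  | nil => rfl
  | cons i w ih => exact congrArg (F i) ih

lemma Fw_cons (i : Fin 6) (w : List (Fin 6)) (x : Plane) : Fw (i :: w) x = F i (Fw w x) := rfl

lemma F_injective (i : Fin 6) : Function.Injective (F i) :=
  Function.LeftInverse.injective (Finv_F i)

lemma q_injective : Function.Injective q := by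
  intro i j h
  have := congrArg (fun x => bary x i) h
  simp only [bary_q] at this
  by_contra hij
  simp [hij] at this

lemma Fw_injective (w : List (Fin 6)) : Function.Injective (Fw w) := by
  induction w with
  | nil => exact Function.injective_id
  | cons i w ih => exact (F_injective i).comp ih

lemma Fw_mem_SG (w : List (Fin 6)) {x : Plane} (hx : x ∈ SG) : Fw w x ∈ SG := by
  induction w with
  | nil => exact hx
  | cons i w ih => exact F_mem_SG i ih

lemma continuous_Fw (w : List (Fin 6)) : Continuous (Fw w) := by
  induction w with
  | nil => exact continuous_id
  | cons i w ih => exact (continuous_F i).comp ih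

lemma exists_F_eq {x : Plane} (hx : x ∈ SG) : ∃ i, ∃ y ∈ SG, x = F i y := by
  rw [SG_eq_iUnion] at hx
  obtain ⟨i, y, hy, rfl⟩ := Set.mem_iUnion.1 hx
  exact ⟨i, y, hy, rfl⟩

lemma exists_Fw_eq (n : ℕ) : ∀ {x : Plane}, x ∈ SG →
    ∃ w : List (Fin 6), w.length = n ∧ ∃ y ∈ SG, x = Fw w y := by
  induction n with
  | zero => exact fun {x} hx => ⟨[], rfl, x, hx, rfl⟩
  | succ n ih =>
    intro x hx
    obtain ⟨i, y, hy, rfl⟩ := exists_F_eq hx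
    obtain ⟨w, hw, z, hz, rfl⟩ := ih hy
    exact ⟨i :: w, by simp [hw], z, hz, rfl⟩

lemma mem_V_iff (m : ℕ) : ∀ x : Plane,
    x ∈ V m ↔ ∃ w : List (Fin 6), w.length = m ∧ ∃ j, x = Fw w (q j) := by
  induction m with
  | zero =>
    intro x
    constructor
    · rintro ⟨j, rfl⟩
      exact ⟨[], rfl, j, rfl⟩
    · rintro ⟨w, hw, j, rfl⟩
      rw [List.length_eq_zero_iff] at hw
      subst hw
      exact ⟨j, rfl⟩
  | succ m ih =>
    intro x
    constructor
    · intro hx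
      obtain ⟨i, y, hy, rfl⟩ := Set.mem_iUnion.1 hx
      obtain ⟨w, hw, j, rfl⟩ := (ih y).1 hy
      exact ⟨i :: w, by simp [hw], j, rfl⟩
    · rintro ⟨w, hw, j, rfl⟩
      cases w with
      | nil => simp at hw
      | cons i w => exact Set.mem_iUnion.2 ⟨i, _, (ih _).2 ⟨w, by simpa using hw, j, rfl⟩, rfl⟩

lemma F_eq_q {i : Fin 6} {k : Fin 3} {y : Plane} (hy : y ∈ SG) (h : F i y = q k) :
    i = corner k ∧ y = q k := by
  have hi : i = corner k := by
    have y0 := bary_nonneg hy 0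
    have y1 := bary_nonneg hy 1
    have y2 := bary_nonneg hy 2
    have sy := bary_sum y
    have hk : ∀ l, bary y l + sh i l = 3 * if l = k then 1 else 0 := by
      intro l
      have := congrArg (fun z => bary z l) h
      simp only [bary_F, bary_q] at this
      linarith
    have k0 := hk 0
    have k1 := hk 1
    have k2 := hk 2
    fin_cases i <;> fin_cases k <;> simp [sh] at k0 k1 k2 <;>
      first
      | rfl
      | (exfalso; linarith)
  refine ⟨hi, F_injective i ?_⟩
  rw [h, hi, F_corner]

/-- Labels of the ten vertices of level one: `lab i j` is the label of `F_i q_j`. -/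
def lab : Fin 6 → Fin 3 → Fin 10 :=
  ![![0, 3, 4], ![5, 1, 6], ![7, 8, 2], ![9, 6, 8], ![4, 9, 7], ![3, 5, 9]]

lemma F_q_eq_iff (i j : Fin 6) (a c : Fin 3) : F i (q a) = F j (q c) ↔ lab i a = lab j c := by
  let s : Fin 6 → Fin 3 → ℕ :=
    ![![2, 0, 0], ![0, 2, 0], ![0, 0, 2], ![0, 1, 1], ![1, 0, 1], ![1, 1, 0]]
  have hs : ∀ i k, sh i k = s i k := by
    intro i k
    fin_cases i <;> fin_cases k <;> simp [sh, s]
  have comb : ∀ (i j : Fin 6) (a c : Fin 3),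
      (∀ k, (if k = a then 1 else 0) + s i k = (if k = c then 1 else 0) + s j k) ↔
        lab i a = lab j c := by decide
  rw [← comb]
  constructor
  · intro h k
    have := congrArg (fun z => bary z k) h
    simp only [bary_F, bary_q, hs] at this
    have h3 : ((if k = a then (1 : ℝ) else 0) + s i k) = (if k = c then 1 else 0) + s j k := by
      linarith
    exact_mod_cast h3
  · intro h
    apply bary_inj
    intro k
    have h3 : ((if k = a then (1 : ℝ) else 0) + s i k) = (if k = c then 1 else 0) + s j k := by
      exact_mod_cast h k
    simp only [bary_F, bary_q, hs, h3]

lemma lab_injective (i : Fin 6) : Function.Injective (lab i) := by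
  intro a c
  revert i a c
  decide

lemma lab_of_F_q_eq_F {i j : Fin 6} {a : Fin 3} {y : Plane} (hy : y ∈ SG)
    (h : F j y = F i (q a)) : ∃ b, y = q b ∧ lab j b = lab i a := by
  by_cases hij : j = i
  · subst hij
    exact ⟨a, F_injective _ h, rfl⟩
  · obtain ⟨b, _, h1, _, _⟩ := overlap 0 hij hy (q_mem_SG a) h
    refine ⟨b, h1, ?_⟩
    rwa [h1, F_q_eq_iff] at h

/-! ### The energy forms -/

lemma energy_zero (u v : Plane → ℝ) :
    energy 0 u v = triForm (fun j => u (q j)) (fun j => v (q j)) := by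
  simp [energy, cellForm, Fw]

lemma energy_congr₂ (m : ℕ) {u u' v v' : Plane → ℝ} (h : ∀ x ∈ V m, u x = u' x)
    (h' : ∀ x ∈ V m, v x = v' x) : energy m u v = energy m u' v' := by
  have hw : ∀ (w : Fin m → Fin 6) j, Fw (List.ofFn w) (q j) ∈ V m :=
    fun w j => (mem_V_iff m _).2 ⟨_, by simp, j, rfl⟩
  simp only [energy, cellForm, h _ (hw _ _), h' _ (hw _ _)]

lemma energy_comm (m : ℕ) (u v : Plane → ℝ) : energy m u v = energy m v u := by
  simp only [energy, cellForm, triForm, mul_comm]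

lemma energy_zero_right (m : ℕ) (u : Plane → ℝ) : energy m u (fun _ => 0) = 0 := by
  simp [energy, cellForm, triForm]

/-- The values of `h` follow the harmonic extension algorithm. -/
def IsDiscreteHarmonic (h : Plane → ℝ) : Prop :=
  ∀ w i j, h (Fw w (F i (q j))) = ext (fun k => h (Fw w (q k))) i j

lemma IsDiscreteHarmonic.comp_F {h : Plane → ℝ} (hh : IsDiscreteHarmonic h) (i : Fin 6) :
    IsDiscreteHarmonic (h ∘ F i) := fun w j k => hh (i :: w) j k

lemma energy_one_eq {u v : Plane → ℝ} (hv : ∀ i j, v (F i (q j)) = ext (fun k => v (q k)) i j) :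
    energy 1 u v = energy 0 u v := by
  obtain ⟨g1, g2, g3, g4, g5, g6, g7, g8⟩ := F_q_glue
  have c0 : F 0 (q 0) = q 0 := F_corner 0
  have c1 : F 1 (q 1) = q 1 := F_corner 1
  have c2 : F 2 (q 2) = q 2 := F_corner 2
  rw [energy_succ]
  simp only [energy_zero, Function.comp, hv, triForm, Fin.sum_univ_six, c0, c1, c2,
    g1, g2, g3, g4, g5, g6, g7, g8, ext, Matrix.cons_val]
  ring

lemma IsDiscreteHarmonic.energy_eq {v : Plane → ℝ} (hv : IsDiscreteHarmonic v) (n : ℕ)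
    (u : Plane → ℝ) : energy n u v = energy 0 u v := by
  induction n generalizing u v with
  | zero => rfl
  | succ n ih =>
    rw [energy_succ, ← energy_one_eq (hv []), energy_succ]
    simp only [ih (hv.comp_F _)]

lemma eq_zero_of_gap_nonpos {d1 d2 d3 d4 d5 d6 d7 : ℝ}
    (h : 15 / 7 * ((d1 ^ 2 + d2 ^ 2 + (d1 - d2) ^ 2) + (d3 ^ 2 + d4 ^ 2 + (d3 - d4) ^ 2) +
        (d5 ^ 2 + d6 ^ 2 + (d5 - d6) ^ 2) +
        ((d7 - d4) ^ 2 + (d4 - d6) ^ 2 + (d6 - d7) ^ 2) +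
        ((d2 - d7) ^ 2 + (d7 - d5) ^ 2 + (d5 - d2) ^ 2) +
        ((d1 - d3) ^ 2 + (d3 - d7) ^ 2 + (d7 - d1) ^ 2)) ≤ 0) :
    d1 = 0 ∧ d2 = 0 ∧ d3 = 0 ∧ d4 = 0 ∧ d5 = 0 ∧ d6 = 0 ∧ d7 = 0 := by
  have s1 := sq_nonneg d1
  have s2 := sq_nonneg d2
  have s3 := sq_nonneg d3
  have s4 := sq_nonneg d4
  have s5 := sq_nonneg d5
  have s6 := sq_nonneg d6
  have r : 0 ≤ (d1 - d2) ^ 2 + (d3 - d4) ^ 2 + (d5 - d6) ^ 2 +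
      ((d4 - d6) ^ 2 + (d6 - d7) ^ 2) + ((d2 - d7) ^ 2 + (d7 - d5) ^ 2 + (d5 - d2) ^ 2) +
      ((d1 - d3) ^ 2 + (d3 - d7) ^ 2 + (d7 - d1) ^ 2) := by positivity
  have s7 := sq_nonneg (d7 - d4)
  have e : ∀ x : ℝ, x ^ 2 ≤ 0 → x = 0 := fun x hx =>
    pow_eq_zero_iff two_ne_zero |>.1 (le_antisymm hx (sq_nonneg x))
  have z4 : d4 = 0 := e _ (by linarith)
  have z7 : d7 - d4 = 0 := e _ (by linarith)
  exact ⟨e _ (by linarith), e _ (by linarith), e _ (by linarith), z4, e _ (by linarith),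
    e _ (by linarith), by linarith⟩

lemma energy_one_sub (v : Plane → ℝ) : energy 0 v v ≤ energy 1 v v ∧
    (energy 1 v v ≤ energy 0 v v → ∀ i j, v (F i (q j)) = ext (fun k => v (q k)) i j) := by
  obtain ⟨g1, g2, g3, g4, g5, g6, g7, g8⟩ := F_q_glue
  have c0 : F 0 (q 0) = q 0 := F_corner 0
  have c1 : F 1 (q 1) = q 1 := F_corner 1
  have c2 : F 2 (q 2) = q 2 := F_corner 2
  rw [energy_succ]
  simp only [energy_zero, Function.comp, triForm, Fin.sum_univ_six]
  have key : ∀ b0 b1 b2 a1 a2 a3 a4 a5 a6 a7 : ℝ,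
      v (q 0) = b0 → v (q 1) = b1 → v (q 2) = b2 → v (F 5 (q 0)) = a1 → v (F 4 (q 0)) = a2 →
      v (F 5 (q 1)) = a3 → v (F 3 (q 1)) = a4 → v (F 4 (q 2)) = a5 → v (F 3 (q 2)) = a6 →
      v (F 5 (q 2)) = a7 → ∀ d1 d2 d3 d4 d5 d6 d7 : ℝ,
      d1 = a1 - (8 * b0 + 4 * b1 + 3 * b2) / 15 → d2 = a2 - (8 * b0 + 3 * b1 + 4 * b2) / 15 →
      d3 = a3 - (4 * b0 + 8 * b1 + 3 * b2) / 15 → d4 = a4 - (3 * b0 + 8 * b1 + 4 * b2) / 15 →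
      d5 = a5 - (4 * b0 + 3 * b1 + 8 * b2) / 15 → d6 = a6 - (3 * b0 + 4 * b1 + 8 * b2) / 15 →
      d7 = a7 - (b0 + b1 + b2) / 3 →
      15 / 7 * (((b0 - a1) * (b0 - a1) + (a1 - a2) * (a1 - a2) + (a2 - b0) * (a2 - b0)) +
        ((a3 - b1) * (a3 - b1) + (b1 - a4) * (b1 - a4) + (a4 - a3) * (a4 - a3)) +
        ((a5 - a6) * (a5 - a6) + (a6 - b2) * (a6 - b2) + (b2 - a5) * (b2 - a5)) +
        ((a7 - a4) * (a7 - a4) + (a4 - a6) * (a4 - a6) + (a6 - a7) * (a6 - a7)) +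
        ((a2 - a7) * (a2 - a7) + (a7 - a5) * (a7 - a5) + (a5 - a2) * (a5 - a2)) +
        ((a1 - a3) * (a1 - a3) + (a3 - a7) * (a3 - a7) + (a7 - a1) * (a7 - a1))) -
      ((b0 - b1) * (b0 - b1) + (b1 - b2) * (b1 - b2) + (b2 - b0) * (b2 - b0)) =
      15 / 7 * ((d1 ^ 2 + d2 ^ 2 + (d1 - d2) ^ 2) + (d3 ^ 2 + d4 ^ 2 + (d3 - d4) ^ 2) +
        (d5 ^ 2 + d6 ^ 2 + (d5 - d6) ^ 2) +
        ((d7 - d4) ^ 2 + (d4 - d6) ^ 2 + (d6 - d7) ^ 2) +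
        ((d2 - d7) ^ 2 + (d7 - d5) ^ 2 + (d5 - d2) ^ 2) +
        ((d1 - d3) ^ 2 + (d3 - d7) ^ 2 + (d7 - d1) ^ 2)) := by
    intros
    subst_vars
    ring
  have key' := key _ _ _ _ _ _ _ _ _ _ rfl rfl rfl rfl rfl rfl rfl rfl rfl rfl
    _ _ _ _ _ _ _ rfl rfl rfl rfl rfl rfl rfl
  simp only [c0, c1, c2, g1, g2, g3, g4, g5, g6, g7, g8]
  constructor
  · rw [← sub_nonneg, key']
    positivity
  intro h
  rw [← sub_nonpos, key'] at h
  clear key key'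
  generalize e1 : v (F 5 (q 0)) - (8 * v (q 0) + 4 * v (q 1) + 3 * v (q 2)) / 15 = d1 at h
  generalize e2 : v (F 4 (q 0)) - (8 * v (q 0) + 3 * v (q 1) + 4 * v (q 2)) / 15 = d2 at h
  generalize e3 : v (F 5 (q 1)) - (4 * v (q 0) + 8 * v (q 1) + 3 * v (q 2)) / 15 = d3 at h
  generalize e4 : v (F 3 (q 1)) - (3 * v (q 0) + 8 * v (q 1) + 4 * v (q 2)) / 15 = d4 at h
  generalize e5 : v (F 4 (q 2)) - (4 * v (q 0) + 3 * v (q 1) + 8 * v (q 2)) / 15 = d5 at h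
  generalize e6 : v (F 3 (q 2)) - (3 * v (q 0) + 4 * v (q 1) + 8 * v (q 2)) / 15 = d6 at h
  generalize e7 : v (F 5 (q 2)) - (v (q 0) + v (q 1) + v (q 2)) / 3 = d7 at h
  obtain ⟨z1, z2, z3, z4, z5, z6, z7⟩ := eq_zero_of_gap_nonpos h
  intro i j
  fin_cases i <;> fin_cases j <;>
    simp [c0, c1, c2, g1, g2, g3, g4, g5, g6, g7, g8, ext] <;> linarith

lemma energy_le_succ (m : ℕ) (v : Plane → ℝ) : energy m v v ≤ energy (m + 1) v v := by
  induction m generalizing v with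
  | zero => exact (energy_one_sub v).1
  | succ m ih =>
    rw [energy_succ, energy_succ (m + 1)]
    gcongr
    exact ih _

lemma ext_of_energy_succ_le (m : ℕ) (v : Plane → ℝ) (h : energy (m + 1) v v ≤ energy m v v) :
    ∀ w : List (Fin 6), w.length = m → ∀ i j,
      v (Fw w (F i (q j))) = ext (fun k => v (Fw w (q k))) i j := by
  induction m generalizing v with
  | zero =>
    intro w hw
    rw [List.length_eq_zero_iff] at hw
    subst hw
    exact (energy_one_sub v).2 h
  | succ m ih =>
    intro w hw
    cases w with
    | nil => simp at hw
    | cons i w =>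
      refine ih (v ∘ F i) ?_ w (by simpa using hw)
      rw [energy_succ, energy_succ m] at h
      by_contra hlt
      push Not at hlt
      have : ∑ j, energy m (v ∘ F j) (v ∘ F j) < ∑ j, energy (m + 1) (v ∘ F j) (v ∘ F j) :=
        Finset.sum_lt_sum (fun j _ => energy_le_succ m _) ⟨i, Finset.mem_univ _, hlt⟩
      linarith

lemma IsHarmonic.isDiscreteHarmonic {h : Plane → ℝ} (hh : IsHarmonic h) :
    IsDiscreteHarmonic h := by
  obtain ⟨H, -, hq, hF⟩ := exists_ext
  have hH : ∀ b, IsDiscreteHarmonic (H b) := by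
    intro b w
    induction w generalizing b with
    | nil =>
      intro i j
      simp only [Fw, id, hF b i _ (q_mem_SG j), hq]
    | cons k w ih =>
      intro i j
      simp only [Fw_cons, hF b k _ (Fw_mem_SG w (F_mem_SG i (q_mem_SG j))), ih,
        hF b k _ (Fw_mem_SG w (q_mem_SG _))]
  set g := H (fun j => h (q j)) with hg
  have gd : IsDiscreteHarmonic g := hH _
  have main : ∀ m, (∀ x ∈ V m, g x = h x) ∧ ∀ w : List (Fin 6), w.length = m → ∀ i j,
      h (Fw w (F i (q j))) = ext (fun k => h (Fw w (q k))) i j := by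
    intro m
    have step : ∀ m, (∀ x ∈ V m, g x = h x) → ∀ w : List (Fin 6), w.length = m → ∀ i j,
        h (Fw w (F i (q j))) = ext (fun k => h (Fw w (q k))) i j := by
      intro m hm
      refine ext_of_energy_succ_le m h ((hh.2 m g hm).trans ?_)
      rw [gd.energy_eq, ← gd.energy_eq m, energy_congr₂ m hm hm]
    induction m with
    | zero =>
      have : ∀ x ∈ V 0, g x = h x := by
        rintro _ ⟨j, rfl⟩
        exact hq _ j
      exact ⟨this, step 0 this⟩
    | succ m ih =>
      have : ∀ x ∈ V (m + 1), g x = h x := by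
        intro x hx
        obtain ⟨w, hw, j, rfl⟩ := (mem_V_iff _ _).1 hx
        obtain ⟨v, i, rfl⟩ := List.eq_nil_or_concat w |>.resolve_left (by rintro rfl; simp at hw)
        have hv : v.length = m := by simpa using hw
        rw [List.concat_eq_append, Fw_append]
        change g (Fw v (F i (q j))) = h (Fw v (F i (q j)))
        rw [gd, ih.2 v hv]
        congr 1
        funext k
        exact ih.1 _ ((mem_V_iff _ _).2 ⟨v, hv, k, rfl⟩)
      exact ⟨this, step _ this⟩
  exact fun w => (main w.length).2 w rfl

/-! ### Comparison principles -/

lemma le_on_SG {h : Plane → ℝ} (hc : ContinuousOn h SG) {c : ℝ}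
    (hw : ∀ w j, c ≤ h (Fw w (q j))) {x : Plane} (hx : x ∈ SG) : c ≤ h x := by
  have hcl : IsClosed (SG ∩ h ⁻¹' Set.Ici c) :=
    hc.preimage_isClosed_of_isClosed isClosed_closure isClosed_Ici
  refine (closure_minimal ?_ hcl hx).2
  intro y hy
  obtain ⟨m, hm⟩ := Set.mem_iUnion.1 hy
  obtain ⟨w, -, j, rfl⟩ := (mem_V_iff _ _).1 hm
  exact ⟨Fw_mem_SG w (q_mem_SG j), hw w j⟩

lemma le_ext {b : Fin 3 → ℝ} {c : ℝ} (hb : ∀ k, c ≤ b k) (i : Fin 6) (j : Fin 3) :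
    c ≤ ext b i j := by
  have b0 := hb 0
  have b1 := hb 1
  have b2 := hb 2
  fin_cases i <;> fin_cases j <;> simp [ext] <;> linarith

lemma IsDiscreteHarmonic.le_of_le {h : Plane → ℝ} (hd : IsDiscreteHarmonic h)
    (hc : ContinuousOn h SG) {c : ℝ} (hq : ∀ j, c ≤ h (q j)) {x : Plane} (hx : x ∈ SG) :
    c ≤ h x := by
  refine le_on_SG hc (fun w => ?_) hx
  clear hc hx
  induction w generalizing h with
  | nil => exact hq
  | cons i w ih =>
    refine ih (hd.comp_F i) fun j => ?_
    simp only [Function.comp]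
    rw [show F i (q j) = Fw [] (F i (q j)) from rfl, hd]
    exact le_ext hq i j

lemma IsDiscreteHarmonic.comp_F_q {h : Plane → ℝ} (hd : IsDiscreteHarmonic h) (i : Fin 6)
    (j : Fin 3) : h (F i (q j)) = ext (fun k => h (q k)) i j := hd [] i j

lemma IsDiscreteHarmonic.pos_of_pos {h : Plane → ℝ} (hd : IsDiscreteHarmonic h)
    (hc : ContinuousOn h SG) (hq : ∀ j, 0 < h (q j)) {x : Plane} (hx : x ∈ SG) : 0 < h x := by
  obtain ⟨k, hk⟩ := Finite.exists_min fun j => h (q j)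
  exact (hq k).trans_le (hd.le_of_le hc hk hx)

lemma continuousOn_comp_F {h : Plane → ℝ} (hc : ContinuousOn h SG) (i : Fin 6) :
    ContinuousOn (h ∘ F i) SG :=
  hc.comp (continuous_F i).continuousOn fun _ hx => F_mem_SG i hx

lemma IsDiscreteHarmonic.pos_of_ne {h : Plane → ℝ} (hd : IsDiscreteHarmonic h)
    (hc : ContinuousOn h SG) {c : Fin 3} (h0 : h (q c) = 0) (hq : ∀ j, j ≠ c → 0 < h (q j))
    {x : Plane} (hx : x ∈ SG) (hxc : x ≠ q c) : 0 < h x := by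
  have key : ∀ n : ℕ, ∀ h : Plane → ℝ, IsDiscreteHarmonic h → ContinuousOn h SG → h (q c) = 0 →
      (∀ j, j ≠ c → 0 < h (q j)) → ∀ x ∈ SG, bary x c < 1 - (1 / 3) ^ n → 0 < h x := by
    intro n
    induction n with
    | zero =>
      intro h _ _ _ _ x hx hb
      have := bary_nonneg hx c
      norm_num at hb
      linarith
    | succ n ih =>
      intro h hd hc h0 hq x hx hb
      obtain ⟨i, y, hy, rfl⟩ := exists_F_eq hx
      have val : ∀ j, (h ∘ F i) (q j) = ext (fun k => h (q k)) i j := hd.comp_F_q i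
      by_cases hi : i = corner c
      · refine ih (h ∘ F i) (hd.comp_F i) (continuousOn_comp_F hc i) ?_ ?_ y hy ?_
        · rw [val, hi, ext_corner, h0]
        · intro j hj
          rw [val, hi]
          clear hb ih
          have p0 := hq 0
          have p1 := hq 1
          have p2 := hq 2
          fin_cases c <;> simp at h0 p0 p1 p2 <;> fin_cases j <;> simp [ext, corner] at hj ⊢ <;>
            linarith
        · have : sh i c = 2 := by rw [hi]; fin_cases c <;> simp [corner, sh]
          rw [bary_F, this, pow_succ] at hb
          linarith
      · refine (hd.comp_F i).pos_of_pos (continuousOn_comp_F hc i) ?_ hy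
        intro j
        rw [val]
        clear hb ih
        have p0 := hq 0
        have p1 := hq 1
        have p2 := hq 2
        fin_cases c <;> simp [corner] at hi h0 p0 p1 p2 <;>
          fin_cases i <;> simp at hi <;> fin_cases j <;> simp [ext, h0] <;> linarith
  have hlt : bary x c < 1 := by
    by_contra hge
    exact hxc (eq_of_bary_one hx c (not_lt.1 hge))
  obtain ⟨n, hn⟩ := exists_pow_lt_of_lt_one (sub_pos.2 hlt) (by norm_num : (1 / 3 : ℝ) < 1)
  exact key n h hd hc h0 hq x hx (by linarith)

lemma IsDiscreteHarmonic.eqOn {h g : Plane → ℝ} (hd : IsDiscreteHarmonic h)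
    (gd : IsDiscreteHarmonic g) (hc : ContinuousOn h SG) (gc : ContinuousOn g SG)
    (hq : ∀ j, h (q j) = g (q j)) {x : Plane} (hx : x ∈ SG) : h x = g x := by
  have key : ∀ w j, h (Fw w (q j)) = g (Fw w (q j)) := by
    intro w
    clear hc gc hx
    induction w generalizing h g with
    | nil => exact hq
    | cons i w ih =>
      refine ih (hd.comp_F i) (gd.comp_F i) fun j => ?_
      simp only [Function.comp, hd.comp_F_q, gd.comp_F_q, hq]
  have h1 := le_on_SG (hc.sub gc) (c := 0) (fun w j => by simp [key]) hx
  have h2 := le_on_SG (gc.sub hc) (c := 0) (fun w j => by simp [key]) hx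
  simp only [Pi.sub_apply] at h1 h2
  linarith

lemma IsDiscreteHarmonic.const_mul {h : Plane → ℝ} (hd : IsDiscreteHarmonic h) (c : ℝ) :
    IsDiscreteHarmonic fun x => c * h x := by
  intro w i j
  simp only [hd w i j]
  fin_cases i <;> fin_cases j <;> simp [ext] <;> ring

lemma harmonicExt_isDiscreteHarmonic (b : Fin 3 → ℝ) : IsDiscreteHarmonic (harmonicExt b) :=
  (harmonicExt_spec b).1.isDiscreteHarmonic

lemma harmonicExt_continuousOn (b : Fin 3 → ℝ) : ContinuousOn (harmonicExt b) SG :=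
  (harmonicExt_spec b).1.1

lemma harmonicExt_zero {x : Plane} (hx : x ∈ SG) : harmonicExt (fun _ => 0) x = 0 := by
  refine IsDiscreteHarmonic.eqOn (g := fun _ => 0) (harmonicExt_isDiscreteHarmonic _) ?_
    (harmonicExt_continuousOn _) continuousOn_const (fun j => (harmonicExt_spec _).2 j) hx
  intro w i j
  fin_cases i <;> fin_cases j <;> simp [ext]

/-! ### The antisymmetric harmonic function and the half domain -/

lemma ha_isDiscreteHarmonic : IsDiscreteHarmonic ha := harmonicExt_isDiscreteHarmonic _

lemma ha_continuousOn : ContinuousOn ha SG := harmonicExt_continuousOn _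

lemma ha_q (j : Fin 3) : ha (q j) = (![0, 1, -1] : Fin 3 → ℝ) j := (harmonicExt_spec _).2 j

lemma ha_q0 : ha (q 0) = 0 := ha_q 0

lemma ha_q1 : ha (q 1) = 1 := ha_q 1

lemma ha_q2 : ha (q 2) = -1 := ha_q 2

lemma ha_F0 {x : Plane} (hx : x ∈ SG) : ha (F 0 x) = 1 / 15 * ha x := by
  refine (ha_isDiscreteHarmonic.comp_F 0).eqOn (ha_isDiscreteHarmonic.const_mul _)
    (continuousOn_comp_F ha_continuousOn 0) (ha_continuousOn.const_mul _) (fun j => ?_) hx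
  simp only [Function.comp, ha_isDiscreteHarmonic.comp_F_q, ha_q]
  fin_cases j <;> simp [ext] <;> norm_num

lemma ha_F3 {x : Plane} (hx : x ∈ SG) : ha (F 3 x) = 4 / 15 * ha x := by
  refine (ha_isDiscreteHarmonic.comp_F 3).eqOn (ha_isDiscreteHarmonic.const_mul _)
    (continuousOn_comp_F ha_continuousOn 3) (ha_continuousOn.const_mul _) (fun j => ?_) hx
  simp only [Function.comp, ha_isDiscreteHarmonic.comp_F_q, ha_q]
  fin_cases j <;> simp [ext] <;> norm_num

lemma ha_F1_pos {x : Plane} (hx : x ∈ SG) : 0 < ha (F 1 x) := by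
  refine (ha_isDiscreteHarmonic.comp_F 1).pos_of_pos (continuousOn_comp_F ha_continuousOn 1)
    (fun j => ?_) hx
  simp only [Function.comp, ha_isDiscreteHarmonic.comp_F_q, ha_q]
  fin_cases j <;> simp [ext] <;> norm_num

lemma ha_F5_q2 : ha (F 5 (q 2)) = 0 := by
  simp [ha_isDiscreteHarmonic.comp_F_q, ha_q, ext]

lemma ha_F4_q1 : ha (F 4 (q 1)) = 0 := by
  simp [ha_isDiscreteHarmonic.comp_F_q, ha_q, ext]

lemma ha_F5_pos {x : Plane} (hx : x ∈ SG) (h2 : x ≠ q 2) : 0 < ha (F 5 x) := by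
  refine (ha_isDiscreteHarmonic.comp_F 5).pos_of_ne (continuousOn_comp_F ha_continuousOn 5)
    ha_F5_q2 (fun j hj => ?_) hx h2
  simp only [Function.comp, ha_isDiscreteHarmonic.comp_F_q, ha_q]
  fin_cases j <;> simp [ext] at hj ⊢ <;> norm_num

lemma ha_F2_neg {x : Plane} (hx : x ∈ SG) : ha (F 2 x) < 0 := by
  have := ((ha_isDiscreteHarmonic.const_mul (-1)).comp_F 2).pos_of_pos
    (continuousOn_comp_F (ha_continuousOn.const_mul _) 2) (fun j => ?_) hx
  · simp only [Function.comp] at this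
    linarith
  simp only [Function.comp, ha_isDiscreteHarmonic.comp_F_q, ha_q]
  fin_cases j <;> simp [ext] <;> norm_num

lemma ha_F4_neg {x : Plane} (hx : x ∈ SG) (h1 : x ≠ q 1) : ha (F 4 x) < 0 := by
  have := ((ha_isDiscreteHarmonic.const_mul (-1)).comp_F 4).pos_of_ne (c := 1)
    (continuousOn_comp_F (ha_continuousOn.const_mul _) 4) (by simp [ha_F4_q1])
    (fun j hj => ?_) hx h1
  · simp only [Function.comp] at this
    linarith
  simp only [Function.comp, ha_isDiscreteHarmonic.comp_F_q, ha_q]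
  fin_cases j <;> simp [ext] at hj ⊢ <;> norm_num

lemma F1_mem_Omega {x : Plane} (hx : x ∈ SG) (h1 : x ≠ q 1) : F 1 x ∈ Omega := by
  refine ⟨F_mem_SG 1 hx, ?_, ha_F1_pos hx⟩
  rintro ⟨k, hk⟩
  obtain ⟨hi, hq⟩ := F_eq_q hx hk.symm
  fin_cases k <;> simp [corner] at hi
  exact h1 hq

lemma F5_mem_Omega {x : Plane} (hx : x ∈ SG) (h2 : x ≠ q 2) : F 5 x ∈ Omega := by
  refine ⟨F_mem_SG 5 hx, ?_, ha_F5_pos hx h2⟩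
  rintro ⟨k, hk⟩
  obtain ⟨hi, hq⟩ := F_eq_q hx hk.symm
  fin_cases k <;> simp [corner] at hi

lemma F3_mem_Omega {x : Plane} (hx : x ∈ SG) (h : 0 < ha x) : F 3 x ∈ Omega := by
  refine ⟨F_mem_SG 3 hx, ?_, by rw [ha_F3 hx]; positivity⟩
  rintro ⟨k, hk⟩
  obtain ⟨hi, hq⟩ := F_eq_q hx hk.symm
  fin_cases k <;> simp [corner] at hi

lemma F0_mem_Omega {x : Plane} (hx : x ∈ SG) (h : 0 < ha x) : F 0 x ∈ Omega := by
  refine ⟨F_mem_SG 0 hx, ?_, by rw [ha_F0 hx]; positivity⟩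
  rintro ⟨k, hk⟩
  obtain ⟨hi, hq⟩ := F_eq_q hx hk.symm
  fin_cases k <;> simp [corner] at hi
  subst hq
  simp [ha_q0] at h

lemma F_q_mem_X : F 3 (q 0) ∈ X :=
  ⟨F_mem_SG 3 (q_mem_SG 0), by simp [ha_F3 (q_mem_SG 0), ha_q0]⟩

lemma X_subset {x : Plane} (hx : x ∈ X) : ∃ i : Fin 6, (i = 0 ∨ i = 3) ∧ ∃ y ∈ X, x = F i y := by
  have c5 : F 5 (q 2) = F 3 (q 0) := by rw [F_q_eq_iff]; rfl
  have c4 : F 4 (q 1) = F 3 (q 0) := by rw [F_q_eq_iff]; rfl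
  have q0 : q 0 ∈ X := ⟨q_mem_SG 0, ha_q0⟩
  obtain ⟨hS, h0⟩ := hx
  obtain ⟨i, y, hy, rfl⟩ := exists_F_eq hS
  by_cases h5 : i = 5
  · subst h5
    by_cases hy2 : y = q 2
    · exact ⟨3, Or.inr rfl, q 0, q0, by rw [hy2, c5]⟩
    · exact absurd h0 (ha_F5_pos hy hy2).ne'
  by_cases h4 : i = 4
  · subst h4
    by_cases hy1 : y = q 1
    · exact ⟨3, Or.inr rfl, q 0, q0, by rw [hy1, c4]⟩
    · exact absurd h0 (ha_F4_neg hy hy1).ne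
  fin_cases i
  · refine ⟨0, Or.inl rfl, y, ⟨hy, ?_⟩, rfl⟩
    have := ha_F0 hy
    change ha (F 0 y) = 0 at h0
    linarith
  · exact absurd h0 (ha_F1_pos hy).ne'
  · exact absurd h0 (ha_F2_neg hy).ne
  · refine ⟨3, Or.inr rfl, y, ⟨hy, ?_⟩, rfl⟩
    have := ha_F3 hy
    change ha (F 3 y) = 0 at h0
    linarith
  · exact absurd rfl h4
  · exact absurd rfl h5

lemma dist_F (i : Fin 6) (x y : Plane) : dist (F i x) (F i y) = 1 / 3 * dist x y := by
  simp [F, dist_smul₀]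

lemma closure_Omega : closure Omega = {x | x ∈ SG ∧ 0 ≤ ha x} := by
  have hcl : IsClosed (SG ∩ ha ⁻¹' Set.Ici 0) :=
    ha_continuousOn.preimage_isClosed_of_isClosed isClosed_closure isClosed_Ici
  apply Set.Subset.antisymm
  · exact closure_minimal (fun x hx => ⟨hx.1, hx.2.2.le⟩) hcl
  have q1n : ∀ y ∈ Omega, y ≠ q 1 := by
    rintro y hy rfl
    exact hy.2.1 ⟨1, rfl⟩
  obtain ⟨C, hC⟩ := Metric.isBounded_iff.1 SG_isCompact.isBounded
  have key : ∀ n : ℕ, ∀ x, (x ∈ X ∨ x = q 1) → ∃ y ∈ Omega, dist x y ≤ (1 / 3) ^ n * C := by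
    intro n
    induction n with
    | zero =>
      intro x hx
      have q01 : q 0 ≠ q 1 := fun h => by simpa using q_injective h
      have hO := F1_mem_Omega (q_mem_SG 0) q01
      have hxS : x ∈ SG := by
        rcases hx with hx | rfl
        · exact hx.1
        · exact q_mem_SG 1
      exact ⟨_, hO, by simpa using hC hxS hO.1⟩
    | succ n ih =>
      rintro x (hx | rfl)
      · obtain ⟨i, hi, y, hy, rfl⟩ := X_subset hx
        obtain ⟨z, hz, hd⟩ := ih y (Or.inl hy)
        refine ⟨F i z, ?_, ?_⟩
        · rcases hi with rfl | rfl
          · exact F0_mem_Omega hz.1 hz.2.2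
          · exact F3_mem_Omega hz.1 hz.2.2
        · rw [dist_F, pow_succ]
          linarith
      · obtain ⟨z, hz, hd⟩ := ih _ (Or.inr rfl)
        refine ⟨F 1 z, F1_mem_Omega hz.1 (q1n z hz), ?_⟩
        have : F 1 (q 1) = q 1 := F_corner 1
        rw [← this, dist_F, pow_succ]
        linarith
  have key' : ∀ x, (x ∈ X ∨ x = q 1) → x ∈ closure Omega := by
    intro x hx
    rw [Metric.mem_closure_iff]
    intro ε hε
    have ht : Tendsto (fun n : ℕ => ((1 : ℝ) / 3) ^ n * C) atTop (𝓝 (0 * C)) :=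
      (tendsto_pow_atTop_nhds_zero_of_lt_one (by norm_num) (by norm_num)).mul_const C
    rw [zero_mul] at ht
    obtain ⟨n, hn⟩ := (ht.eventually (gt_mem_nhds hε)).exists
    obtain ⟨y, hy, hd⟩ := key n x hx
    exact ⟨y, hy, hd.trans_lt hn⟩
  rintro x ⟨hS, h0⟩
  rcases h0.eq_or_lt with h0 | h0
  · exact key' x (Or.inl ⟨hS, h0.symm⟩)
  by_cases hV : x ∈ V 0
  · obtain ⟨k, rfl⟩ := hV
    fin_cases k
    · simp [ha_q0] at h0
    · exact key' _ (Or.inr rfl)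
    · have := ha_q2
      simp at h0
      linarith
  · exact subset_closure ⟨hS, hV, h0⟩

lemma closure_Omega_subset : closure Omega ⊆ SG := fun _ hx => by
  rw [closure_Omega] at hx
  exact hx.1

lemma isCompact_closure_Omega : IsCompact (closure Omega) :=
  SG_isCompact.of_isClosed_subset isClosed_closure closure_Omega_subset

lemma mem_closure_Omega {x : Plane} (hx : x ∈ SG) (h : 0 ≤ ha x) : x ∈ closure Omega := by
  rw [closure_Omega]
  exact ⟨hx, h⟩

lemma F_mem_closure_Omega {i : Fin 6} (hi : i = 0 ∨ i = 3) {x : Plane} (hx : x ∈ closure Omega) :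
    F i x ∈ closure Omega := by
  rw [closure_Omega] at hx ⊢
  obtain ⟨hS, h0⟩ := hx
  refine ⟨F_mem_SG i hS, ?_⟩
  rcases hi with rfl | rfl
  · rw [ha_F0 hS]; positivity
  · rw [ha_F3 hS]; positivity

lemma F1_mem_closure {x : Plane} (hx : x ∈ SG) : F 1 x ∈ closure Omega :=
  mem_closure_Omega (F_mem_SG 1 hx) (ha_F1_pos hx).le

lemma F5_mem_closure {x : Plane} (hx : x ∈ SG) : F 5 x ∈ closure Omega := by
  refine mem_closure_Omega (F_mem_SG 5 hx) ?_
  by_cases h : x = q 2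
  · rw [h, ha_F5_q2]
  · exact (ha_F5_pos hx h).le

lemma q1_mem_closure : q 1 ∈ closure Omega :=
  mem_closure_Omega (q_mem_SG 1) (by rw [ha_q1]; norm_num)

lemma X_subset_closure : X ⊆ closure Omega := fun _ hx => mem_closure_Omega hx.1 hx.2.ge

/-! ### Gluing functions along cells -/

open Classical in
/-- The function that is `g i ∘ F_i⁻¹` on the cell `F_i SG`. -/
noncomputable def glue (g : Fin 6 → Plane → ℝ) (x : Plane) : ℝ :=
  if h : ∃ i, Finv i x ∈ SG then g h.choose (Finv h.choose x) else 0

lemma glue_F {g : Fin 6 → Plane → ℝ}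
    (hg : ∀ i j a c, F i (q a) = F j (q c) → g i (q a) = g j (q c)) (i : Fin 6) {x : Plane}
    (hx : x ∈ SG) : glue g (F i x) = g i x := by
  have hex : ∃ j, Finv j (F i x) ∈ SG := ⟨i, by rwa [Finv_F]⟩
  rw [glue, dif_pos hex]
  have hc := hex.choose_spec
  generalize hex.choose = j at hc
  by_cases hij : j = i
  · subst hij; rw [Finv_F]
  · obtain ⟨a, c, h1, h2, -⟩ := overlap 0 hij hc hx (F_Finv j (F i x))
    have h3 := F_Finv j (F i x)
    rw [h1, h2] at h3
    rw [h1, h2, hg _ _ _ _ h3]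

/-- The function that is harmonic on every `n`-cell and agrees with `v` on `V_n`. -/
noncomputable def piecewiseHarmonic : ℕ → (Plane → ℝ) → Plane → ℝ
  | 0, v => harmonicExt fun j => v (q j)
  | n + 1, v => glue fun i => piecewiseHarmonic n (v ∘ F i)

lemma piecewiseHarmonic_spec (n : ℕ) :
    (∀ v j, piecewiseHarmonic n v (q j) = v (q j)) ∧
    ∀ v i, ∀ x ∈ SG, piecewiseHarmonic (n + 1) v (F i x) = piecewiseHarmonic n (v ∘ F i) x := by
  have step : ∀ n, (∀ v j, piecewiseHarmonic n v (q j) = v (q j)) →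
      ∀ v i, ∀ x ∈ SG, piecewiseHarmonic (n + 1) v (F i x) = piecewiseHarmonic n (v ∘ F i) x := by
    intro n hn v i x hx
    refine glue_F (fun i j a c h => ?_) i hx
    simp only [hn, Function.comp, h]
  have hq : ∀ v j, piecewiseHarmonic n v (q j) = v (q j) := by
    induction n with
    | zero => exact fun v j => (harmonicExt_spec _).2 j
    | succ n ih =>
      intro v j
      have := step n ih v (corner j) (q j) (q_mem_SG j)
      rw [F_corner] at this
      rw [this, ih, Function.comp, F_corner]
  exact ⟨hq, step n hq⟩

lemma energy_piecewiseHarmonic (n m : ℕ) (u v : Plane → ℝ) :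
    energy (n + m) u (piecewiseHarmonic n v) = energy n u v := by
  induction n generalizing u v with
  | zero =>
    rw [piecewiseHarmonic, (harmonicExt_isDiscreteHarmonic _).energy_eq, energy_zero, energy_zero]
    simp only [(harmonicExt_spec _).2]
  | succ n ih =>
    rw [show n + 1 + m = n + m + 1 by omega, energy_succ, energy_succ]
    congr 1
    refine Finset.sum_congr rfl fun i _ => ?_
    rw [← ih]
    exact energy_congr₂ _ (fun _ _ => rfl) fun x hx =>
      (piecewiseHarmonic_spec n).2 v i x (V_subset_SG _ hx)

lemma piecewiseHarmonic_eq_zero (w : List (Fin 6)) : ∀ v : Plane → ℝ,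
    (∀ j, v (Fw w (q j)) = 0) → ∀ x ∈ SG, piecewiseHarmonic w.length v (Fw w x) = 0 := by
  induction w with
  | nil =>
    intro v hv x hx
    have : (fun j => v (q j)) = fun _ => 0 := funext hv
    simp only [List.length_nil, piecewiseHarmonic, this, Fw, id]
    exact harmonicExt_zero hx
  | cons i w ih =>
    intro v hv x hx
    rw [List.length_cons, Fw_cons, (piecewiseHarmonic_spec _).2 _ _ _ (Fw_mem_SG w hx)]
    exact ih _ hv x hx

/-! ### Discrete harmonicity in the half domain -/

/-- The discrete equations `E_n(u, v) = 0` on all levels, for all `v` that vanish at the vertices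
of the `n`-cells that are not contained in the half domain. -/
def HalfHarmonic (u : Plane → ℝ) : Prop :=
  ∀ (n : ℕ) (v : Plane → ℝ), (∀ w : List (Fin 6), w.length = n → ¬ Fw w '' SG ⊆ Omega →
    ∀ j, v (Fw w (q j)) = 0) → energy n u v = 0

lemma LaplacianZeroInOmega.halfHarmonic {u : Plane → ℝ} (hu : LaplacianZeroInOmega u) :
    HalfHarmonic u := by
  intro n v hv
  set P := piecewiseHarmonic n v with hP
  have hbad : ∀ w : List (Fin 6), w.length = n → ¬ Fw w '' SG ⊆ Omega →
      ∀ x ∈ SG, P (Fw w x) = 0 := by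
    intro w hw hO x hx
    have := piecewiseHarmonic_eq_zero w v (hv w hw hO) x hx
    rwa [hw] at this
  have hconst : ∀ m, n ≤ m → ∀ f, energy m f P = energy n f v := by
    intro m hm f
    obtain ⟨k, rfl⟩ := Nat.exists_eq_add_of_le hm
    exact energy_piecewiseHarmonic n k f v
  have hfin : FiniteEnergy P := by
    have : Tendsto (fun m => energy m P P) atTop (𝓝 (energy n P v)) :=
      tendsto_const_nhds.congr' <| by
        filter_upwards [eventually_ge_atTop n] with m hm
        exact (hconst m hm P).symm
    exact this.bddAbove_range
  let C : Set Plane := ⋃ w : {w : Fin n → Fin 6 // Fw (List.ofFn w) '' SG ⊆ Omega},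
    Fw (List.ofFn w.1) '' SG
  have hC : IsCompact C :=
    isCompact_iUnion fun w => SG_isCompact.image (continuous_Fw _)
  have hE := hu P hfin ⟨C, hC, Set.iUnion_subset fun w => w.2, ?_⟩
  · have : Tendsto (fun m => energyOmega m u P) atTop (𝓝 (energy n u v)) := by
      classical
      refine tendsto_const_nhds.congr' ?_
      filter_upwards [eventually_ge_atTop n] with m hm
      rw [← hconst m hm, energy, energyOmega]
      congr 1
      symm
      refine Finset.sum_subset (Finset.filter_subset _ _) fun w _ hw => ?_
      have hw' : ¬ Fw (List.ofFn w) '' SG ⊆ closure Omega := by simpa using hw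
      have hz : ∀ j, P (Fw (List.ofFn w) (q j)) = 0 := by
        intro j
        rw [← List.take_append_drop n (List.ofFn w), Fw_append]
        refine hbad _ (by simp [hm]) (fun hsub => hw' ?_) _ (Fw_mem_SG _ (q_mem_SG j))
        rintro _ ⟨x, hx, rfl⟩
        rw [← List.take_append_drop n (List.ofFn w), Fw_append]
        exact subset_closure (hsub ⟨_, Fw_mem_SG _ hx, rfl⟩)
      simp [cellForm, hz, triForm]
    exact tendsto_nhds_unique this hE
  · intro x hx hxC
    obtain ⟨w, hw, y, hy, rfl⟩ := exists_Fw_eq n hx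
    refine hbad w hw (fun hsub => hxC ?_) y hy
    subst hw
    exact Set.mem_iUnion.2 ⟨⟨w.get, by simpa using hsub⟩, y, hy, by simp⟩

/-- The function that is `φ ∘ F_i⁻¹` on `F_i SG` and zero elsewhere. -/
noncomputable def lift (i : Fin 6) (φ : Plane → ℝ) : Plane → ℝ :=
  glue fun j x => if j = i then φ x else 0

lemma lift_F {φ : Plane → ℝ} (hφ : ∀ k, φ (q k) = 0) (i j : Fin 6) {x : Plane} (hx : x ∈ SG) :
    lift i φ (F j x) = if j = i then φ x else 0 := by
  refine glue_F (g := fun j x => if j = i then φ x else 0) (fun i j a c h => ?_) j hx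
  simp [hφ]

lemma lift_q {φ : Plane → ℝ} (hφ : ∀ k, φ (q k) = 0) (i : Fin 6) (k : Fin 3) :
    lift i φ (q k) = 0 := by
  rw [← F_corner k, lift_F hφ _ _ (q_mem_SG k)]
  simp [hφ]

lemma energy_lift {φ : Plane → ℝ} (hφ : ∀ k, φ (q k) = 0) (i : Fin 6) (n : ℕ) (u : Plane → ℝ) :
    energy (n + 1) u (lift i φ) = 15 / 7 * energy n (u ∘ F i) φ := by
  rw [energy_succ, Finset.sum_eq_single i]
  · congr 1
    refine energy_congr₂ n (fun _ _ => rfl) fun x hx => ?_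
    simp [lift_F hφ i i (V_subset_SG n hx)]
  · intro j _ hj
    rw [← energy_zero_right n (u ∘ F j)]
    refine energy_congr₂ n (fun _ _ => rfl) fun x hx => ?_
    simp [lift_F hφ i j (V_subset_SG n hx), hj]
  · simp

/-- The discrete equations at all points except `q₀, q₁, q₂`. -/
def InnerHarmonic (u : Plane → ℝ) : Prop :=
  ∀ (n : ℕ) (φ : Plane → ℝ), (∀ j, φ (q j) = 0) → energy n u φ = 0

/-- The discrete equations away from a boundary vertex `q_c`. -/
def CornerHarmonic (c : Fin 3) (u : Plane → ℝ) : Prop :=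
  ∀ (n : ℕ) (φ : Plane → ℝ), (∀ j, φ (q j) = 0) → (∀ j, φ ((F (corner c))^[n] (q j)) = 0) →
    energy n u φ = 0

lemma InnerHarmonic.comp_F {u : Plane → ℝ} (hu : InnerHarmonic u) (i : Fin 6) :
    InnerHarmonic (u ∘ F i) := by
  intro n φ hφ
  have := hu (n + 1) (lift i φ) (lift_q hφ i)
  rw [energy_lift hφ] at this
  linarith

lemma iterate_mem_SG (i : Fin 6) (n : ℕ) {x : Plane} (hx : x ∈ SG) : (F i)^[n] x ∈ SG := by
  induction n with
  | zero => exact hx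
  | succ n ih =>
    rw [Function.iterate_succ_apply']
    exact F_mem_SG i ih

lemma CornerHarmonic.comp_F_corner {c : Fin 3} {u : Plane → ℝ} (hu : CornerHarmonic c u) :
    CornerHarmonic c (u ∘ F (corner c)) := by
  intro n φ hφ hc
  have := hu (n + 1) (lift (corner c) φ) (lift_q hφ _) fun j => by
    rw [Function.iterate_succ_apply', lift_F hφ _ _ (iterate_mem_SG _ _ (q_mem_SG j)), hc]
    simp
  rw [energy_lift hφ] at this
  linarith

lemma CornerHarmonic.comp_F {c : Fin 3} {u : Plane → ℝ} (hu : CornerHarmonic c u) {i : Fin 6}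
    (hi : i ≠ corner c) : InnerHarmonic (u ∘ F i) := by
  intro n φ hφ
  have := hu (n + 1) (lift i φ) (lift_q hφ _) fun j => by
    rw [Function.iterate_succ_apply', lift_F hφ _ _ (iterate_mem_SG _ _ (q_mem_SG j)),
      if_neg hi.symm]
  rw [energy_lift hφ] at this
  linarith

/-! ### Fluxes at vertices -/

open Classical in
/-- The indicator function of a point. -/
noncomputable def delta (p x : Plane) : ℝ := if x = p then 1 else 0

lemma delta_F_F (i : Fin 6) (p x : Plane) : delta (F i p) (F i x) = delta p x := by
  simp [delta, (F_injective i).eq_iff]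

lemma delta_q_q (b j : Fin 3) : delta (q b) (q j) = if j = b then 1 else 0 := by
  simp [delta, q_injective.eq_iff]

lemma delta_F_q_q {i : Fin 6} {a : Fin 3} (h : ∀ j, lab (corner j) j ≠ lab i a) (j : Fin 3) :
    delta (F i (q a)) (q j) = 0 := by
  rw [delta, if_neg]
  rw [← F_corner j, F_q_eq_iff]
  exact h j

/-- The graph Laplacian of level `n` at a vertex `q_b`, scaled as a normal derivative. -/
noncomputable def flux (n : ℕ) (u : Plane → ℝ) (b : Fin 3) : ℝ := energy n u (delta (q b))

lemma flux_zero (u : Plane → ℝ) (b : Fin 3) :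
    flux 0 u b = 2 * u (q b) - u (q (b + 1)) - u (q (b - 1)) := by
  rw [flux, energy_zero]
  simp only [delta_q_q, triForm]
  have n1 : (-1 : Fin 3) = 2 := rfl
  fin_cases b <;> simp [n1] <;> ring

lemma energy_succ_delta (n : ℕ) (u : Plane → ℝ) (i : Fin 6) (a : Fin 3) :
    energy (n + 1) u (delta (F i (q a))) =
      15 / 7 * ∑ j, ∑ b, if lab j b = lab i a then flux n (u ∘ F j) b else 0 := by
  rw [energy_succ]
  congr 1
  refine Finset.sum_congr rfl fun j _ => ?_
  by_cases h : ∃ b, lab j b = lab i a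
  · obtain ⟨b, hb⟩ := h
    rw [Finset.sum_eq_single b]
    · rw [if_pos hb, flux, ← (F_q_eq_iff _ _ _ _).2 hb]
      congr 1
      funext x
      exact delta_F_F j _ x
    · intro c _ hc
      rw [if_neg]
      rw [← hb]
      exact fun h => hc (lab_injective j h)
    · simp
  · rw [Finset.sum_eq_zero fun b _ => if_neg fun hb => h ⟨b, hb⟩,
      ← energy_zero_right n (u ∘ F j)]
    refine energy_congr₂ n (fun _ _ => rfl) fun x hx => ?_
    rw [Function.comp, delta, if_neg]
    intro hF
    obtain ⟨b, -, hb⟩ := lab_of_F_q_eq_F (V_subset_SG n hx) hF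
    exact h ⟨b, hb⟩

lemma lab_eq_corner : ∀ (b : Fin 3) (j : Fin 6) (c : Fin 3),
    lab j c = lab (corner b) b ↔ j = corner b ∧ c = b := by decide

lemma flux_succ (n : ℕ) (u : Plane → ℝ) (b : Fin 3) :
    flux (n + 1) u b = 15 / 7 * flux n (u ∘ F (corner b)) b := by
  have := energy_succ_delta n u (corner b) b
  rw [F_corner] at this
  rw [flux, this]
  congr 1
  rw [Finset.sum_eq_single (corner b), Finset.sum_eq_single b] <;>
    simp +contextual [lab_eq_corner]

lemma flux_eq (n : ℕ) (u : Plane → ℝ) (b : Fin 3) :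
    flux n u b = (15 / 7 : ℝ) ^ n * (2 * u (q b) - u ((F (corner b))^[n] (q (b + 1))) -
      u ((F (corner b))^[n] (q (b - 1)))) := by
  induction n generalizing u with
  | zero => simp [flux_zero]
  | succ n ih =>
    rw [flux_succ, ih]
    simp only [Function.comp, F_corner, Function.iterate_succ_apply']
    ring

lemma IsDiscreteHarmonic.flux_eq_flux_zero {u : Plane → ℝ} (hu : IsDiscreteHarmonic u) (n : ℕ)
    (b : Fin 3) : flux n u b = flux 0 u b := by
  rw [flux, energy_comm, hu.energy_eq, flux, energy_comm]

/-! ### Weak equations determine the values -/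

/-- The sum over the cells of level one of the fluxes at the vertex with label `l`. -/
noncomputable def balance (n : ℕ) (u : Plane → ℝ) (l : Fin 10) : ℝ :=
  ∑ j, ∑ b, if lab j b = l then flux n (u ∘ F j) b else 0

lemma balance_zero_eq (u : Plane → ℝ) :
    balance 0 u 3 = 4 * u (F 5 (q 0)) - u (F 4 (q 0)) - u (q 0) - u (F 5 (q 1)) - u (F 5 (q 2)) ∧
    balance 0 u 4 = 4 * u (F 4 (q 0)) - u (q 0) - u (F 5 (q 0)) - u (F 5 (q 2)) - u (F 4 (q 2)) ∧
    balance 0 u 5 = 4 * u (F 5 (q 1)) - u (q 1) - u (F 3 (q 1)) - u (F 5 (q 2)) - u (F 5 (q 0)) ∧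
    balance 0 u 6 = 4 * u (F 3 (q 1)) - u (F 5 (q 1)) - u (q 1) - u (F 3 (q 2)) - u (F 5 (q 2)) ∧
    balance 0 u 7 = 4 * u (F 4 (q 2)) - u (F 3 (q 2)) - u (q 2) - u (F 4 (q 0)) - u (F 5 (q 2)) ∧
    balance 0 u 8 = 4 * u (F 3 (q 2)) - u (q 2) - u (F 4 (q 2)) - u (F 5 (q 2)) - u (F 3 (q 1)) ∧
    balance 0 u 9 = 6 * u (F 5 (q 2)) - u (F 3 (q 1)) - u (F 3 (q 2)) - u (F 4 (q 2)) -
      u (F 4 (q 0)) - u (F 5 (q 0)) - u (F 5 (q 1)) := by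
  obtain ⟨g1, g2, g3, g4, g5, g6, g7, g8⟩ := F_q_glue
  have c0 : F 0 (q 0) = q 0 := F_corner 0
  have c1 : F 1 (q 1) = q 1 := F_corner 1
  have c2 : F 2 (q 2) = q 2 := F_corner 2
  have n1 : (-1 : Fin 3) = 2 := rfl
  refine ⟨?_, ?_, ?_, ?_, ?_, ?_, ?_⟩ <;>
    simp [balance, Fin.sum_univ_succ, lab, flux_zero, c0, c1, c2, g1, g2, g3, g4, g5, g6, g7, g8,
      n1] <;> ring

lemma flux_one_eq (u : Plane → ℝ) :
    flux 1 u 0 = 15 / 7 * (2 * u (q 0) - u (F 5 (q 0)) - u (F 4 (q 0))) ∧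
    flux 1 u 1 = 15 / 7 * (2 * u (q 1) - u (F 3 (q 1)) - u (F 5 (q 1))) ∧
    flux 1 u 2 = 15 / 7 * (2 * u (q 2) - u (F 4 (q 2)) - u (F 3 (q 2))) := by
  obtain ⟨g1, g2, g3, g4, g5, g6, g7, g8⟩ := F_q_glue
  have c0 : F 0 (q 0) = q 0 := F_corner 0
  have c1 : F 1 (q 1) = q 1 := F_corner 1
  have c2 : F 2 (q 2) = q 2 := F_corner 2
  have n1 : (-1 : Fin 3) = 2 := rfl
  refine ⟨?_, ?_, ?_⟩ <;>
    simp [flux_succ, corner, flux_zero, c0, c1, c2, g1, g2, g3, g4, g5, g6, n1]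

lemma ext_eq_of_balance {u : Plane → ℝ}
    (h : ∀ l, (∀ j, lab (corner j) j ≠ l) → balance 0 u l = 0) (i : Fin 6) (j : Fin 3) :
    u (F i (q j)) = ext (fun k => u (q k)) i j := by
  obtain ⟨g1, g2, g3, g4, g5, g6, g7, g8⟩ := F_q_glue
  have c0 : F 0 (q 0) = q 0 := F_corner 0
  have c1 : F 1 (q 1) = q 1 := F_corner 1
  have c2 : F 2 (q 2) = q 2 := F_corner 2
  obtain ⟨b3, b4, b5, b6, b7, b8, b9⟩ := balance_zero_eq u
  rw [h _ (by decide)] at b3 b4 b5 b6 b7 b8 b9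
  fin_cases i <;> fin_cases j <;>
    simp [c0, c1, c2, g1, g2, g3, g4, g5, g6, g7, g8, ext] <;> linarith

lemma exists_lab : ∀ l : Fin 10, ∃ i a, lab i a = l := by decide

lemma InnerHarmonic.isDiscreteHarmonic {u : Plane → ℝ} (hu : InnerHarmonic u) :
    IsDiscreteHarmonic u := by
  intro w
  induction w generalizing u with
  | nil =>
    refine ext_eq_of_balance fun l hl => ?_
    obtain ⟨i, a, rfl⟩ := exists_lab l
    have := hu 1 _ (delta_F_q_q hl)
    rw [energy_succ_delta] at this
    rw [balance]
    linarith
  | cons i w ih => exact ih (hu.comp_F i)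

/-- The difference of the normal derivatives of level zero and one at `q_b`. -/
noncomputable def defect (u : Plane → ℝ) (b : Fin 3) : ℝ := flux 0 u b - flux 1 u b

lemma CornerHarmonic.balance_eq_zero {c : Fin 3} {u : Plane → ℝ} (hu : CornerHarmonic c u)
    {l : Fin 10} (hl : ∀ j, lab (corner j) j ≠ l) (hc : ∀ j, lab (corner c) j ≠ l) :
    balance 0 u l = 0 := by
  obtain ⟨i, a, rfl⟩ := exists_lab l
  have := hu 1 _ (delta_F_q_q hl) fun j => by
    rw [Function.iterate_one, delta, if_neg]
    rw [F_q_eq_iff]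
    exact hc j
  rw [energy_succ_delta] at this
  rw [balance]
  linarith

lemma CornerHarmonic.balance_eq_defect {c b : Fin 3} {u : Plane → ℝ} (hu : CornerHarmonic c u)
    (hb : b ≠ c) : balance 0 u (lab (corner c) b) = defect (u ∘ F (corner c)) b := by
  have inner : ∀ c b : Fin 3, b ≠ c → ∀ j, lab (corner j) j ≠ lab (corner c) b := by decide
  have := hu 2 _ (delta_F_q_q (inner c b hb)) fun j => by
    rw [Function.iterate_succ_apply', Function.iterate_one, delta_F_F, delta, if_neg]
    intro h
    obtain ⟨h1, -⟩ := F_eq_q (q_mem_SG j) h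
    have key : ∀ b c : Fin 3, corner c = corner b → b = c := by decide
    exact hb (key b c h1)
  rw [energy_succ_delta] at this
  have h1 : balance 1 u (lab (corner c) b) = 0 := by
    rw [balance]
    linarith
  rw [← sub_zero (balance 0 u _), ← h1, balance, balance, ← Finset.sum_sub_distrib,
    Finset.sum_eq_single (corner c)]
  · rw [← Finset.sum_sub_distrib, Finset.sum_eq_single b]
    · simp [defect]
    · intro d _ hd
      rw [if_neg (fun h => hd (lab_injective _ h)), if_neg (fun h => hd (lab_injective _ h)),
        sub_self]
    · simp
  · intro j _ hj
    simp [(hu.comp_F hj).isDiscreteHarmonic.flux_eq_flux_zero 1]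
  · simp

lemma CornerHarmonic.defect_eq {c : Fin 3} {u : Plane → ℝ} (hu : CornerHarmonic c u) :
    defect u (c + 1) = (4 * defect (u ∘ F (corner c)) (c + 1) +
      3 * defect (u ∘ F (corner c)) (c - 1)) / 7 ∧
    defect u (c - 1) = (4 * defect (u ∘ F (corner c)) (c - 1) +
      3 * defect (u ∘ F (corner c)) (c + 1)) / 7 := by
  have ne : ∀ c : Fin 3, c + 1 ≠ c ∧ c - 1 ≠ c := by decide
  rw [← hu.balance_eq_defect (ne c).1, ← hu.balance_eq_defect (ne c).2]
  obtain ⟨b3, b4, b5, b6, b7, b8, b9⟩ := balance_zero_eq u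
  obtain ⟨f0, f1, f2⟩ := flux_one_eq u
  have z : ∀ l, (∀ j, lab (corner j) j ≠ l) → (∀ j, lab (corner c) j ≠ l) →
    balance 0 u l = 0 := fun _ => hu.balance_eq_zero
  have n1 : (-1 : Fin 3) = 2 := rfl
  have p1 : (1 + 1 : Fin 3) = 2 := rfl
  have p2 : (2 + 1 : Fin 3) = 0 := rfl
  have p3 : (2 - 1 : Fin 3) = 1 := rfl
  fin_cases c
  · have z5 := z 5 (by decide) (by decide)
    have z6 := z 6 (by decide) (by decide)
    have z7 := z 7 (by decide) (by decide)
    have z8 := z 8 (by decide) (by decide)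
    have z9 := z 9 (by decide) (by decide)
    simp [defect, flux_zero, f1, f2, n1, p1, p2, p3, lab, corner]
    constructor <;> linarith
  · have z3 := z 3 (by decide) (by decide)
    have z4 := z 4 (by decide) (by decide)
    have z7 := z 7 (by decide) (by decide)
    have z8 := z 8 (by decide) (by decide)
    have z9 := z 9 (by decide) (by decide)
    simp [defect, flux_zero, f0, f2, n1, p1, p2, p3, lab, corner]
    constructor <;> linarith
  · have z3 := z 3 (by decide) (by decide)
    have z4 := z 4 (by decide) (by decide)
    have z5 := z 5 (by decide) (by decide)
    have z6 := z 6 (by decide) (by decide)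
    have z9 := z 9 (by decide) (by decide)
    simp [defect, flux_zero, f0, f1, n1, p1, p2, p3, lab, corner]
    constructor <;> linarith

lemma tendsto_iterate_F_corner (c : Fin 3) (x : Plane) :
    Tendsto (fun n => (F (corner c))^[n] x) atTop (𝓝 (q c)) := by
  rw [tendsto_iff_dist_tendsto_zero]
  have : ∀ n, dist ((F (corner c))^[n] x) (q c) = (1 / 3) ^ n * dist x (q c) := by
    intro n
    induction n with
    | zero => simp
    | succ n ih =>
      nth_rw 1 [← F_corner c]
      rw [Function.iterate_succ_apply', dist_F, ih, pow_succ]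
      ring
  simp only [this]
  simpa using (tendsto_pow_atTop_nhds_zero_of_lt_one (by norm_num : (0 : ℝ) ≤ 1 / 3)
    (by norm_num)).mul_const (dist x (q c))

lemma tendsto_defect {c : Fin 3} {u : Plane → ℝ} (hc : ContinuousOn u SG) (b : Fin 3) :
    Tendsto (fun n => defect (u ∘ (F (corner c))^[n]) b) atTop (𝓝 0) := by
  have h : ∀ x ∈ SG, Tendsto (fun n => (u ∘ (F (corner c))^[n]) x) atTop (𝓝 (u (q c))) := by
    intro x hx
    refine (hc (q c) (q_mem_SG c)).tendsto.comp
      (tendsto_nhdsWithin_iff.2 ⟨tendsto_iterate_F_corner c x, ?_⟩)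
    exact Eventually.of_forall fun n => iterate_mem_SG _ n hx
  simp only [defect, flux_eq]
  have ht := (((h _ (q_mem_SG b)).const_mul 2).sub (h _ (q_mem_SG (b + 1)))).sub
    (h _ (q_mem_SG (b - 1)))
  have ht' := (((h _ (q_mem_SG b)).const_mul 2).sub
    (h _ (F_mem_SG (corner b) (q_mem_SG (b + 1))))).sub
    (h _ (F_mem_SG (corner b) (q_mem_SG (b - 1))))
  have := (ht.const_mul ((15 / 7 : ℝ) ^ 0)).sub (ht'.const_mul ((15 / 7 : ℝ) ^ 1))
  refine (this.trans (le_of_eq ?_))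
  congr 1
  ring

lemma CornerHarmonic.defect_eq_zero {c : Fin 3} {u : Plane → ℝ} (hu : CornerHarmonic c u)
    (hc : ContinuousOn u SG) : defect u (c + 1) = 0 ∧ defect u (c - 1) = 0 := by
  have bound : ∀ n : ℕ, ∀ u, CornerHarmonic c u →
      max |defect u (c + 1)| |defect u (c - 1)| ≤
        max |defect (u ∘ (F (corner c))^[n]) (c + 1)|
          |defect (u ∘ (F (corner c))^[n]) (c - 1)| := by
    intro n
    induction n with
    | zero => intro u _; rfl
    | succ n ih =>
      intro u hu
      have h := ih _ hu.comp_F_corner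
      rw [Function.comp_assoc, ← Function.iterate_succ'] at h
      refine le_trans ?_ h
      obtain ⟨h1, h2⟩ := hu.defect_eq
      rw [h1, h2]
      generalize defect (u ∘ F (corner c)) (c + 1) = s
      generalize defect (u ∘ F (corner c)) (c - 1) = t
      have hs := le_max_left |s| |t|
      have ht := le_max_right |s| |t|
      have := abs_le.1 (le_refl |s|)
      have := abs_le.1 (le_refl |t|)
      refine max_le (abs_le.2 ⟨?_, ?_⟩) (abs_le.2 ⟨?_, ?_⟩) <;> linarith
  have ht := (tendsto_defect (c := c) hc (c + 1)).abs.max (tendsto_defect (c := c) hc (c - 1)).abs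
  have := ge_of_tendsto' ht fun n => bound n u hu
  simp only [abs_zero, max_self] at this
  exact ⟨abs_nonpos_iff.1 ((le_max_left _ _).trans this),
    abs_nonpos_iff.1 ((le_max_right _ _).trans this)⟩

lemma CornerHarmonic.isDiscreteHarmonic {c : Fin 3} {u : Plane → ℝ} (hu : CornerHarmonic c u)
    (hc : ContinuousOn u SG) : IsDiscreteHarmonic u := by
  intro w
  induction w generalizing u with
  | nil =>
    refine ext_eq_of_balance fun l hl => ?_
    by_cases h : ∃ b, lab (corner c) b = l
    · obtain ⟨b, rfl⟩ := h
      have hb : b ≠ c := by rintro rfl; exact hl _ rfl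
      rw [hu.balance_eq_defect hb]
      obtain ⟨h1, h2⟩ := hu.comp_F_corner.defect_eq_zero (continuousOn_comp_F hc _)
      have cases : ∀ b c : Fin 3, b ≠ c → b = c + 1 ∨ b = c - 1 := by decide
      rcases cases b c hb with rfl | rfl
      · exact h1
      · exact h2
    · exact hu.balance_eq_zero hl fun j hj => h ⟨j, hj⟩
  | cons i w ih =>
    by_cases hi : i = corner c
    · subst hi
      exact ih hu.comp_F_corner (continuousOn_comp_F hc _)
    · exact (hu.comp_F hi).isDiscreteHarmonic w

/-! ### Block equations in the half domain -/

lemma Fw_replicate (n : ℕ) (i : Fin 6) (x : Plane) : Fw (List.replicate n i) x = (F i)^[n] x := by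
  induction n with
  | zero => rfl
  | succ n ih => rw [List.replicate_succ, Fw_cons, ih, Function.iterate_succ_apply']

lemma iterate_F_corner (n : ℕ) (c : Fin 3) : (F (corner c))^[n] (q c) = q c :=
  Function.iterate_fixed (F_corner c) n

lemma Fw_eq_q {c : Fin 3} {x : Plane} (hx : x ∈ SG) : ∀ w : List (Fin 6), Fw w x = q c →
    w = List.replicate w.length (corner c) := by
  intro w
  induction w with
  | nil => exact fun _ => rfl
  | cons i w ih =>
    intro h
    obtain ⟨h1, h2⟩ := F_eq_q (Fw_mem_SG w hx) h
    rw [List.length_cons, List.replicate_succ, ← ih h2, h1]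

lemma q_notMem_Omega (k : Fin 3) : q k ∉ Omega := fun h => h.2.1 ⟨k, rfl⟩

lemma HalfHarmonic.comp_F {u : Plane → ℝ} (hu : HalfHarmonic u) {i : Fin 6}
    (hi : i = 0 ∨ i = 3) : HalfHarmonic (u ∘ F i) := by
  intro n φ hφ
  have hq : ∀ k, φ (q k) = 0 := by
    intro k
    have := hφ (List.replicate n (corner k)) (by simp)
      (fun hsub => q_notMem_Omega k (hsub ⟨q k, q_mem_SG k, ?_⟩)) k
    all_goals rw [Fw_replicate, iterate_F_corner] at *
    exact this
  have := hu (n + 1) (lift i φ) fun w hw hO j => by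
    cases w with
    | nil => simp at hw
    | cons k w =>
      rw [Fw_cons, lift_F hq _ _ (Fw_mem_SG w (q_mem_SG j))]
      split_ifs with hk
      · subst hk
        refine hφ w (by simpa using hw) (fun hsub => hO ?_) j
        rintro _ ⟨x, hx, rfl⟩
        have hΩ := hsub ⟨x, hx, rfl⟩
        rcases hi with rfl | rfl
        · exact F0_mem_Omega hΩ.1 hΩ.2.2
        · exact F3_mem_Omega hΩ.1 hΩ.2.2
      · rfl
  rw [energy_lift hq] at this
  linarith

lemma HalfHarmonic.cornerHarmonic {u : Plane → ℝ} (hu : HalfHarmonic u) {i : Fin 6} {c : Fin 3}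
    (hic : ∀ x ∈ SG, x ≠ q c → F i x ∈ Omega) : CornerHarmonic c (u ∘ F i) := by
  intro n φ hq hc
  have := hu (n + 1) (lift i φ) fun w hw hO j => by
    cases w with
    | nil => simp at hw
    | cons k w =>
      rw [Fw_cons, lift_F hq _ _ (Fw_mem_SG w (q_mem_SG j))]
      split_ifs with hk
      · subst hk
        by_cases hw' : w = List.replicate n (corner c)
        · rw [hw', Fw_replicate, hc]
        · refine absurd ?_ hO
          rintro _ ⟨x, hx, rfl⟩
          refine hic _ (Fw_mem_SG w hx) fun h => hw' ?_
          have := Fw_eq_q hx w h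
          rwa [show w.length = n by simpa using hw] at this
      · rfl
  rw [energy_lift hq] at this
  linarith

lemma HalfHarmonic.balance_eq_zero {u : Plane → ℝ} (hu : HalfHarmonic u) {l : Fin 10}
    (hl : ∀ j b, lab j b = l → ∀ x ∈ SG, F j (F (corner b) x) ∈ Omega) : balance 1 u l = 0 := by
  obtain ⟨i, a, rfl⟩ := exists_lab l
  have := hu 2 (delta (F i (q a))) fun w hw hO m => by
    obtain ⟨j, k, rfl⟩ := List.length_eq_two.1 hw
    rw [delta, if_neg]
    intro h
    obtain ⟨b, hb, hlab⟩ := lab_of_F_q_eq_F (F_mem_SG k (q_mem_SG m)) h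
    obtain ⟨rfl, -⟩ := F_eq_q (q_mem_SG m) hb
    apply hO
    rintro _ ⟨x, hx, rfl⟩
    exact hl j b hlab x hx
  rw [energy_succ_delta] at this
  rw [balance]
  linarith

/-- Continuous functions on the closed half domain that satisfy all discrete equations and are
bounded by `M`. -/
structure HalfSolution (M : ℝ) (u : Plane → ℝ) : Prop where
  harmonic : HalfHarmonic u
  continuousOn : ContinuousOn u (closure Omega)
  bound : ∀ x ∈ closure Omega, |u x| ≤ M

lemma HalfSolution.comp_F {M : ℝ} {u : Plane → ℝ} (hu : HalfSolution M u) {i : Fin 6}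
    (hi : i = 0 ∨ i = 3) : HalfSolution M (u ∘ F i) where
  harmonic := hu.harmonic.comp_F hi
  continuousOn := hu.continuousOn.comp (continuous_F i).continuousOn
    fun _ hx => F_mem_closure_Omega hi hx
  bound := fun _ hx => hu.bound _ (F_mem_closure_Omega hi hx)

lemma HalfSolution.isDiscreteHarmonic_F1 {M : ℝ} {u : Plane → ℝ} (hu : HalfSolution M u) :
    IsDiscreteHarmonic (u ∘ F 1) :=
  (hu.harmonic.cornerHarmonic fun _ => F1_mem_Omega).isDiscreteHarmonic
    (hu.continuousOn.comp (continuous_F 1).continuousOn fun _ => F1_mem_closure)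

lemma HalfSolution.isDiscreteHarmonic_F5 {M : ℝ} {u : Plane → ℝ} (hu : HalfSolution M u) :
    IsDiscreteHarmonic (u ∘ F 5) :=
  (hu.harmonic.cornerHarmonic fun _ => F5_mem_Omega).isDiscreteHarmonic
    (hu.continuousOn.comp (continuous_F 5).continuousOn fun _ => F5_mem_closure)

lemma corner_ne_q {k : Fin 6} {c : Fin 3} (h : k ≠ corner c) {x : Plane} (hx : x ∈ SG) :
    F k x ≠ q c := fun he => h (F_eq_q hx he).1

/-- The equations at the vertices `F_1 q_0 = F_5 q_1`, `F_1 q_2 = F_3 q_1` and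
`F_5 q_0 = F_0 q_1`. -/
lemma HalfSolution.block {M : ℝ} {u : Plane → ℝ} (hu : HalfSolution M u) :
    4 * u (F 5 (q 1)) = u (q 1) + u (F 3 (q 1)) + u (F 5 (q 0)) + u (F 5 (q 2)) ∧
    2 * u (F 3 (q 1)) - u (q 1) - u (F 5 (q 1)) + flux 1 (u ∘ F 3) 1 = 0 ∧
    2 * u (F 5 (q 0)) - u (F 5 (q 1)) - u (F 5 (q 2)) + flux 1 (u ∘ F 0) 1 = 0 := by
  have f1 := hu.isDiscreteHarmonic_F1.flux_eq_flux_zero 1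
  have f5 := hu.isDiscreteHarmonic_F5.flux_eq_flux_zero 1
  have m1 : ∀ k : Fin 6, k ≠ 1 → ∀ x ∈ SG, F 1 (F k x) ∈ Omega := fun k hk x hx =>
    F1_mem_Omega (F_mem_SG k hx) (corner_ne_q hk hx)
  have m5 : ∀ k : Fin 6, k ≠ 2 → ∀ x ∈ SG, F 5 (F k x) ∈ Omega := fun k hk x hx =>
    F5_mem_Omega (F_mem_SG k hx) (corner_ne_q hk hx)
  have m3 : ∀ x ∈ SG, F 3 (F 1 x) ∈ Omega := fun x hx =>
    F3_mem_Omega (F_mem_SG 1 hx) (ha_F1_pos hx)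
  have m0 : ∀ x ∈ SG, F 0 (F 1 x) ∈ Omega := fun x hx =>
    F0_mem_Omega (F_mem_SG 1 hx) (ha_F1_pos hx)
  have l5 : ∀ j b, lab j b = 5 → (j = 1 ∧ b = 0) ∨ (j = 5 ∧ b = 1) := by decide
  have l6 : ∀ j b, lab j b = 6 → (j = 1 ∧ b = 2) ∨ (j = 3 ∧ b = 1) := by decide
  have l3 : ∀ j b, lab j b = 3 → (j = 5 ∧ b = 0) ∨ (j = 0 ∧ b = 1) := by decide
  have e5 := hu.harmonic.balance_eq_zero (l := 5) fun j b h => by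
    obtain ⟨rfl, rfl⟩ | ⟨rfl, rfl⟩ := l5 j b h
    · exact m1 0 (by decide)
    · exact m5 1 (by decide)
  have e6 := hu.harmonic.balance_eq_zero (l := 6) fun j b h => by
    obtain ⟨rfl, rfl⟩ | ⟨rfl, rfl⟩ := l6 j b h
    · exact m1 2 (by decide)
    · exact m3
  have e3 := hu.harmonic.balance_eq_zero (l := 3) fun j b h => by
    obtain ⟨rfl, rfl⟩ | ⟨rfl, rfl⟩ := l3 j b h
    · exact m5 0 (by decide)
    · exact m0
  obtain ⟨g1, g2, g3, g4, g5, g6, g7, g8⟩ := F_q_glue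
  have c1 : F 1 (q 1) = q 1 := F_corner 1
  have n1 : (-1 : Fin 3) = 2 := rfl
  have p1 : (1 + 1 : Fin 3) = 2 := rfl
  have p2 : (2 + 1 : Fin 3) = 0 := rfl
  have p3 : (2 - 1 : Fin 3) = 1 := rfl
  simp [balance, Fin.sum_univ_succ, lab, f1, f5] at e3 e5 e6
  simp [flux_zero, c1, g3, g4, n1, p1, p2, p3] at e3 e5 e6
  refine ⟨?_, ?_, ?_⟩ <;> linarith

lemma HalfSolution.flux_recursion {M : ℝ} {u : Plane → ℝ} (hu : HalfSolution M u) :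
    flux 1 u 1 - 3 * u (q 1) =
      1 / 7 * (flux 1 (u ∘ F 0) 1 - 3 * (u ∘ F 0) (q 1)) +
      4 / 7 * (flux 1 (u ∘ F 3) 1 - 3 * (u ∘ F 3) (q 1)) - 6 / 7 * u (F 3 (q 0)) := by
  obtain ⟨h1, h2, h3⟩ := hu.block
  obtain ⟨g1, g2, g3, g4, g5, g6, g7, g8⟩ := F_q_glue
  rw [(flux_one_eq u).2.1]
  simp only [Function.comp, g1, g7]
  linarith

lemma HalfSolution.energy_recursion {M : ℝ} {u : Plane → ℝ} (hu : HalfSolution M u) :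
    15 / 7 * (energy 0 (ha ∘ F 1) (u ∘ F 1) + energy 0 (ha ∘ F 5) (u ∘ F 5)) =
      flux 1 u 1 - 1 / 7 * flux 1 (u ∘ F 0) 1 - 4 / 7 * flux 1 (u ∘ F 3) 1 := by
  obtain ⟨h1, h2, h3⟩ := hu.block
  obtain ⟨g1, g2, g3, g4, g5, g6, g7, g8⟩ := F_q_glue
  have c1 : F 1 (q 1) = q 1 := F_corner 1
  rw [(flux_one_eq u).2.1]
  simp only [energy_zero, Function.comp, ha_isDiscreteHarmonic.comp_F_q, ha_q, triForm, g3, g4, c1]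
  simp [ext]
  linarith

/-! ### Energy on the half domain -/

lemma not_forall_ha_nonneg {i : Fin 6} (hi : i = 2 ∨ i = 4) (w : List (Fin 6)) :
    ¬ Fw (i :: w) '' SG ⊆ closure Omega := by
  rw [closure_Omega]
  intro hsub
  have h0 := (hsub ⟨q 0, q_mem_SG 0, rfl⟩).2
  have h1 := (hsub ⟨q 1, q_mem_SG 1, rfl⟩).2
  rw [Fw_cons] at h0 h1
  rcases hi with rfl | rfl
  · exact absurd h0 (ha_F2_neg (Fw_mem_SG w (q_mem_SG 0))).not_ge
  · by_cases hq : Fw w (q 0) = q 1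
    · refine absurd h1 (ha_F4_neg (Fw_mem_SG w (q_mem_SG 1)) fun h => ?_).not_ge
      have := q_injective (Fw_injective w (hq.trans h.symm))
      simp at this
    · exact absurd h0 (ha_F4_neg (Fw_mem_SG w (q_mem_SG 0)) hq).not_ge

lemma cell_subset_iff {i : Fin 6} (hi : i = 0 ∨ i = 3) (w : List (Fin 6)) :
    Fw (i :: w) '' SG ⊆ closure Omega ↔ Fw w '' SG ⊆ closure Omega := by
  constructor
  · rintro h _ ⟨x, hx, rfl⟩
    have := h ⟨x, hx, rfl⟩
    rw [closure_Omega, Fw_cons] at this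
    have h0 := this.2
    refine mem_closure_Omega (Fw_mem_SG w hx) ?_
    rcases hi with rfl | rfl
    · rw [ha_F0 (Fw_mem_SG w hx)] at h0
      linarith
    · rw [ha_F3 (Fw_mem_SG w hx)] at h0
      linarith
  · rintro h _ ⟨x, hx, rfl⟩
    exact F_mem_closure_Omega hi (h ⟨x, hx, rfl⟩)

lemma energyOmega_zero (u v : Plane → ℝ) : energyOmega 0 u v = 0 := by
  have : ¬ SG ⊆ closure Omega := by
    intro h
    have h2 := h (q_mem_SG 2)
    rw [closure_Omega] at h2
    have := h2.2
    rw [ha_q2] at this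
    linarith
  simp [energyOmega, Fw, this]

lemma energyOmega_succ (m : ℕ) (u v : Plane → ℝ) :
    energyOmega (m + 1) u v = 15 / 7 * (energy m (u ∘ F 1) (v ∘ F 1) +
      energy m (u ∘ F 5) (v ∘ F 5) + energyOmega m (u ∘ F 0) (v ∘ F 0) +
      energyOmega m (u ∘ F 3) (v ∘ F 3)) := by
  classical
  have s1 : ∀ w : List (Fin 6), Fw (1 :: w) '' SG ⊆ closure Omega := by
    rintro w _ ⟨x, hx, rfl⟩
    exact F1_mem_closure (Fw_mem_SG w hx)
  have s5 : ∀ w : List (Fin 6), Fw (5 :: w) '' SG ⊆ closure Omega := by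
    rintro w _ ⟨x, hx, rfl⟩
    exact F5_mem_closure (Fw_mem_SG w hx)
  have cell : ∀ i w, cellForm u v (i :: w) = cellForm (u ∘ F i) (v ∘ F i) w := fun _ _ => rfl
  simp only [energyOmega, energy, Finset.sum_filter]
  rw [← (Fin.consEquiv fun _ => Fin 6).sum_comp, Fintype.sum_prod_type, Fin.sum_univ_six]
  simp only [Fin.consEquiv, Equiv.coe_fn_mk, List.ofFn_succ, Fin.cons_zero, Fin.cons_succ, s1, s5,
    if_true, cell_subset_iff (Or.inl rfl : (0 : Fin 6) = 0 ∨ (0 : Fin 6) = 3),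
    cell_subset_iff (Or.inr rfl : (3 : Fin 6) = 0 ∨ (3 : Fin 6) = 3),
    not_forall_ha_nonneg (Or.inl rfl : (2 : Fin 6) = 2 ∨ (2 : Fin 6) = 4),
    not_forall_ha_nonneg (Or.inr rfl : (4 : Fin 6) = 2 ∨ (4 : Fin 6) = 4), if_false,
    Finset.sum_const_zero, cell]
  ring

lemma energyOmega_congr_left (m : ℕ) {u u' : Plane → ℝ} (v : Plane → ℝ)
    (h : ∀ x ∈ SG, u x = u' x) : energyOmega m u v = energyOmega m u' v := by
  simp only [energyOmega, cellForm, h _ (Fw_mem_SG _ (q_mem_SG _))]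

lemma energyOmega_smul_left (m : ℕ) (c : ℝ) (u v : Plane → ℝ) :
    energyOmega m (fun x => c * u x) v = c * energyOmega m u v := by
  simp only [energyOmega, cellForm, triForm, Finset.mul_sum]
  refine Finset.sum_congr rfl fun w _ => ?_
  ring

lemma HalfSolution.energyOmega_recursion {M : ℝ} {u : Plane → ℝ} (hu : HalfSolution M u) (m : ℕ) :
    energyOmega (m + 1) ha u - flux 1 u 1 =
      1 / 7 * (energyOmega m ha (u ∘ F 0) - flux 1 (u ∘ F 0) 1) +
      4 / 7 * (energyOmega m ha (u ∘ F 3) - flux 1 (u ∘ F 3) 1) := by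
  have h := hu.energy_recursion
  rw [energyOmega_succ, hu.isDiscreteHarmonic_F1.energy_eq, hu.isDiscreteHarmonic_F5.energy_eq,
    energyOmega_congr_left m (u ∘ F 0) (u := ha ∘ F 0) (fun x hx => ha_F0 hx),
    energyOmega_congr_left m (u ∘ F 3) (u := ha ∘ F 3) (fun x hx => ha_F3 hx),
    energyOmega_smul_left, energyOmega_smul_left]
  linarith

lemma HalfSolution.abs_le_of_recursion {M C : ℝ} (R : ℕ → (Plane → ℝ) → ℝ)
    (h0 : ∀ u, HalfSolution M u → |R 0 u| ≤ C)
    (hR : ∀ m u, HalfSolution M u →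
      R (m + 1) u = 1 / 7 * R m (u ∘ F 0) + 4 / 7 * R m (u ∘ F 3)) (m : ℕ) :
    ∀ u, HalfSolution M u → |R m u| ≤ (5 / 7) ^ m * C := by
  induction m with
  | zero => simpa using h0
  | succ m ih =>
    intro u hu
    have h1 := abs_le.1 (ih _ (hu.comp_F (Or.inl rfl)))
    have h2 := abs_le.1 (ih _ (hu.comp_F (Or.inr rfl)))
    rw [hR m u hu, pow_succ, abs_le]
    constructor <;> linarith

lemma HalfSolution.abs_flux_le {M : ℝ} {u : Plane → ℝ} (hu : HalfSolution M u) :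
    |flux 1 u 1| ≤ 60 / 7 * M := by
  rw [(flux_one_eq u).2.1]
  have h1 := abs_le.1 (hu.bound _ q1_mem_closure)
  have h2 := abs_le.1 (hu.bound _ (F_mem_closure_Omega (Or.inr rfl) q1_mem_closure))
  have h3 := abs_le.1 (hu.bound _ (F5_mem_closure (q_mem_SG 1)))
  rw [abs_le]
  constructor <;> linarith

lemma tendsto_pow_mul_zero (C : ℝ) : Tendsto (fun m : ℕ => (5 / 7 : ℝ) ^ m * C) atTop (𝓝 0) := by
  simpa using (tendsto_pow_atTop_nhds_zero_of_lt_one (by norm_num : (0 : ℝ) ≤ 5 / 7)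
    (by norm_num)).mul_const C

lemma HalfSolution.hasEnergyOmega {M : ℝ} {u : Plane → ℝ} (hu : HalfSolution M u) :
    HasEnergyOmega ha u (flux 1 u 1) := by
  have h := HalfSolution.abs_le_of_recursion (M := M) (C := 60 / 7 * M)
    (fun m u => energyOmega m ha u - flux 1 u 1)
    (fun u hu => by simpa [energyOmega_zero] using hu.abs_flux_le)
    (fun m u hu => hu.energyOmega_recursion m)
  rw [HasEnergyOmega, ← tendsto_sub_nhds_zero_iff]
  exact squeeze_zero_norm (fun m => h m u hu) (tendsto_pow_mul_zero _)

/-! ### Sums over words -/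

/-- The letter `0`. -/
abbrev letter₀ : {i : Fin 6 // i = 0 ∨ i = 3} := ⟨0, Or.inl rfl⟩

/-- The letter `3`. -/
abbrev letter₃ : {i : Fin 6 // i = 0 ∨ i = 3} := ⟨3, Or.inr rfl⟩

lemma univ_letters :
    (Finset.univ : Finset {i : Fin 6 // i = 0 ∨ i = 3}) = {letter₀, letter₃} := by decide

lemma muWord_nonneg (w : HalfWord) : 0 ≤ muWord w := by
  refine List.prod_nonneg fun x hx => ?_
  obtain ⟨i, -, rfl⟩ := List.mem_map.1 hx
  split_ifs <;> norm_num

lemma summable_muWord : Summable muWord := by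
  rw [← (List.equivSigmaTuple (α := {i : Fin 6 // i = 0 ∨ i = 3})).symm.summable_iff,
    summable_sigma_of_nonneg fun _ => by exact muWord_nonneg _]
  refine ⟨fun n => (hasSum_fintype _).summable, ?_⟩
  have : ∀ n : ℕ, ∑' f : Fin n → {i : Fin 6 // i = 0 ∨ i = 3},
      (muWord ∘ List.equivSigmaTuple.symm) ⟨n, f⟩ = (5 / 7) ^ n := by
    intro n
    have h57 : (5 / 7 : ℝ) = ∑ i : {i : Fin 6 // i = 0 ∨ i = 3},
        if i.1 = 0 then (1 / 7 : ℝ) else 4 / 7 := by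
      rw [univ_letters, Finset.sum_pair (by decide)]
      rw [if_pos rfl, if_neg (by decide)]
      norm_num
    rw [tsum_fintype, h57, Fintype.sum_pow]
    simp [muWord, List.equivSigmaTuple, List.map_ofFn, List.prod_ofFn]
  simp only [this]
  exact summable_geometric_of_lt_one (by norm_num) (by norm_num)

/-- A word is empty or starts with one of the two letters. -/
def wordEquiv : Unit ⊕ HalfWord ⊕ HalfWord ≃ HalfWord where
  toFun := Sum.elim (fun _ => []) (Sum.elim (List.cons letter₀) (List.cons letter₃))
  invFun w := match w with
    | [] => Sum.inl ()
    | i :: w => if i.1 = 0 then Sum.inr (Sum.inl w) else Sum.inr (Sum.inr w)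
  left_inv := by
    rintro (_ | w | w) <;> simp
  right_inv := by
    rintro (_ | ⟨⟨i, rfl | rfl⟩, w⟩) <;> simp

lemma tsum_word {f : HalfWord → ℝ} (hf : Summable f) :
    ∑' w, f w = f [] + (∑' w, f (letter₀ :: w) + ∑' w, f (letter₃ :: w)) := by
  have h0 : Summable fun w => f (letter₀ :: w) := hf.comp_injective List.cons_injective
  have h3 : Summable fun w => f (letter₃ :: w) := hf.comp_injective List.cons_injective
  rw [← wordEquiv.tsum_eq]
  have hu : HasSum (fun _ : Unit => f []) (f []) := hasSum_unique _
  exact (HasSum.sum (f := f ∘ wordEquiv) hu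
    (HasSum.sum (f := (f ∘ wordEquiv) ∘ Sum.inr) h0.hasSum h3.hasSum)).tsum_eq

lemma muWord_nil : muWord [] = 1 := rfl

lemma muWord_cons₀ (w : HalfWord) : muWord (letter₀ :: w) = 1 / 7 * muWord w := by
  simp [muWord]

lemma muWord_cons₃ (w : HalfWord) : muWord (letter₃ :: w) = 4 / 7 * muWord w := by
  simp [muWord]

lemma p_cons (i : {i : Fin 6 // i = 0 ∨ i = 3}) (w : HalfWord) : p (i :: w) = F i (p w) := rfl

lemma tsum_muWord : ∑' w, muWord w = 7 / 2 := by
  have := tsum_word summable_muWord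
  simp only [muWord_nil, muWord_cons₀, muWord_cons₃, tsum_mul_left] at this
  linarith

lemma p_mem_X (w : HalfWord) : p w ∈ X := by
  induction w with
  | nil => exact F_q_mem_X
  | cons i w ih =>
    obtain ⟨hS, h0⟩ := ih
    obtain ⟨i, rfl | rfl⟩ := i
    · exact ⟨F_mem_SG _ hS, by rw [p_cons, ha_F0 hS, h0, mul_zero]⟩
    · exact ⟨F_mem_SG _ hS, by rw [p_cons, ha_F3 hS, h0, mul_zero]⟩

lemma summable_of_bound {M : ℝ} {u : Plane → ℝ} (hu : ∀ x ∈ X, |u x| ≤ M) (c : ℝ) :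
    Summable fun w => c * muWord w * u (p w) := by
  refine Summable.of_norm_bounded (g := fun w => |c| * M * muWord w)
    (summable_muWord.mul_left _) fun w => ?_
  rw [Real.norm_eq_abs, abs_mul, abs_mul, abs_of_nonneg (muWord_nonneg w)]
  have := mul_le_mul_of_nonneg_left (hu _ (p_mem_X w))
    (mul_nonneg (abs_nonneg c) (muWord_nonneg w))
  linarith

lemma HalfSolution.bound_X {M : ℝ} {u : Plane → ℝ} (hu : HalfSolution M u) :
    ∀ x ∈ X, |u x| ≤ M := fun x hx => hu.bound x (X_subset_closure hx)

lemma HalfSolution.flux_eq_tsum {M : ℝ} {u : Plane → ℝ} (hu : HalfSolution M u) :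
    flux 1 u 1 = 3 * u (q 1) - ∑' w, 6 / 7 * muWord w * u (p w) := by
  have bound : ∀ u, HalfSolution M u → |∑' w, 6 / 7 * muWord w * u (p w)| ≤ 3 * M := by
    intro u hu
    rw [← Real.norm_eq_abs]
    have hs : HasSum (fun w => 6 / 7 * M * muWord w) (3 * M) := by
      have := summable_muWord.hasSum.mul_left (6 / 7 * M)
      rwa [tsum_muWord, show 6 / 7 * M * (7 / 2) = 3 * M by ring] at this
    refine tsum_of_norm_bounded hs fun w => ?_
    rw [Real.norm_eq_abs, abs_mul, abs_of_nonneg (mul_nonneg (by norm_num) (muWord_nonneg w))]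
    have := mul_le_mul_of_nonneg_left (hu.bound_X _ (p_mem_X w)) (muWord_nonneg w)
    linarith
  have h := HalfSolution.abs_le_of_recursion (M := M) (C := 60 / 7 * M + 6 * M)
    (fun _ u => flux 1 u 1 - 3 * u (q 1) + ∑' w, 6 / 7 * muWord w * u (p w))
    (fun u hu => by
      have h1 := abs_le.1 hu.abs_flux_le
      have h2 := abs_le.1 (hu.bound _ q1_mem_closure)
      have h3 := abs_le.1 (bound u hu)
      rw [abs_le]
      constructor <;> linarith)
    (fun _ u hu => by
      have h1 := hu.flux_recursion
      have h2 := tsum_word (summable_of_bound hu.bound_X (6 / 7))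
      have h3 : ∀ w, 6 / 7 * (1 / 7 * muWord w) * u (F 0 (p w)) =
        1 / 7 * (6 / 7 * muWord w * (u ∘ F 0) (p w)) := fun w => by
          simp only [Function.comp]
          ring
      have h4 : ∀ w, 6 / 7 * (4 / 7 * muWord w) * u (F 3 (p w)) =
        4 / 7 * (6 / 7 * muWord w * (u ∘ F 3) (p w)) := fun w => by
          simp only [Function.comp]
          ring
      simp only [muWord_nil, muWord_cons₀, muWord_cons₃, p_cons, h3, h4, tsum_mul_left] at h2
      rw [show p [] = F 3 (q 0) from rfl] at h2
      linarith)
  have := ge_of_tendsto' (tendsto_pow_mul_zero _) fun m => h m u hu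
  have := abs_nonpos_iff.1 this
  linarith

lemma flux_succ_eq {M : ℝ} {u : Plane → ℝ} (hu : HalfSolution M u) (m : ℕ) :
    flux (m + 1) u 1 = flux 1 u 1 := by
  rw [flux_succ, flux_succ]
  congr 1
  exact hu.isDiscreteHarmonic_F1.flux_eq_flux_zero m 1

lemma HalfSolution.hasNormalDeriv {M : ℝ} {u : Plane → ℝ} (hu : HalfSolution M u) :
    HasNormalDeriv u 1 (flux 1 u 1) := by
  rw [HasNormalDeriv, ← tendsto_add_atTop_iff_nat 1]
  refine tendsto_const_nhds.congr fun m => ?_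
  rw [← flux_succ_eq hu m, flux_eq]

lemma mu_compl_X : mu Xᶜ = 0 := by
  have hX : MeasurableSet X :=
    (ha_continuousOn.preimage_isClosed_of_isClosed isClosed_closure isClosed_singleton
      (t := {0})).measurableSet
  rw [mu, Measure.sum_apply _ hX.compl]
  simp [p_mem_X]

lemma isProbabilityMeasure_mu : IsProbabilityMeasure mu := by
  constructor
  rw [mu, Measure.sum_apply _ MeasurableSet.univ]
  simp only [Measure.smul_apply, measure_univ, smul_eq_mul, mul_one]
  rw [← ENNReal.ofReal_tsum_of_nonneg (fun w => mul_nonneg (by norm_num) (muWord_nonneg w))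
    (summable_muWord.mul_left _), tsum_mul_left, tsum_muWord]
  norm_num

lemma restrict_mu : mu.restrict X = mu :=
  Measure.restrict_eq_self_of_ae_mem (mem_ae_iff.2 mu_compl_X)

lemma toReal_weight (w : HalfWord) :
    (ENNReal.ofReal (2 / 7 * muWord w)).toReal = 2 / 7 * muWord w :=
  ENNReal.toReal_ofReal (mul_nonneg (by norm_num) (muWord_nonneg w))

lemma summable_weight_mul_norm {M : ℝ} {f : Plane → ℝ} (hf : ∀ x ∈ X, |f x| ≤ M) :
    Summable fun w => (ENNReal.ofReal (2 / 7 * muWord w)).toReal * ‖f (p w)‖ := by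
  simp only [toReal_weight]
  exact summable_of_bound (u := fun x => ‖f x‖) (fun x hx => by simpa using hf x hx) _

lemma integrable_mu {M : ℝ} {f : Plane → ℝ} (hf : ∀ x ∈ X, |f x| ≤ M) : Integrable f mu :=
  integrable_sum_dirac (fun _ => ENNReal.ofReal_ne_top) (summable_weight_mul_norm hf)

lemma integral_mu {M : ℝ} {f : Plane → ℝ} (hf : ∀ x ∈ X, |f x| ≤ M) :
    ∫ x, f x ∂mu = ∑' w, 2 / 7 * muWord w * f (p w) := by
  rw [mu, integral_sum_dirac_eq_tsum (fun _ => ENNReal.ofReal_ne_top)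
    (summable_weight_mul_norm hf)]
  simp only [toReal_weight, smul_eq_mul]

lemma IsDirichletSolution.exists_halfSolution {f u : Plane → ℝ} (hu : IsDirichletSolution f u) :
    ∃ M, HalfSolution M u := by
  obtain ⟨M, hM⟩ := isCompact_closure_Omega.exists_bound_of_continuousOn hu.continuousOn
  exact ⟨M, hu.harmonic.halfHarmonic, hu.continuousOn, hM⟩

end HalfSG3


theorem theorem2p1 (f : HalfSG3.Plane → ℝ) (hf : ContinuousOn f HalfSG3.bdOmega)
    (u : HalfSG3.Plane → ℝ) (hu : HalfSG3.IsDirichletSolution f u) :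
    MeasureTheory.IsProbabilityMeasure HalfSG3.mu ∧
    HalfSG3.mu HalfSG3.Xᶜ = 0 ∧
    MeasureTheory.IntegrableOn f HalfSG3.X HalfSG3.mu ∧
    Summable (fun w : HalfSG3.HalfWord => 6 / 7 * HalfSG3.muWord w * f (HalfSG3.p w)) ∧
    ∃ d : ℝ, HalfSG3.HasNormalDeriv u 1 d ∧
      d = 3 * f (HalfSG3.q 1) -
        ∑' w : HalfSG3.HalfWord, 6 / 7 * HalfSG3.muWord w * f (HalfSG3.p w) ∧
      d = 3 * f (HalfSG3.q 1) - 3 * ∫ x in HalfSG3.X, f x ∂HalfSG3.mu ∧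
      (HalfSG3.FiniteEnergyOmega u → HalfSG3.HasEnergyOmega HalfSG3.ha u d) := by
  open HalfSG3 in
  obtain ⟨M, h⟩ := hu.exists_halfSolution
  have hX : ∀ x ∈ X, u x = f x := fun x hx => hu.boundary x (Or.inr hx)
  have hbound : ∀ x ∈ X, |f x| ≤ M := fun x hx => hX x hx ▸ h.bound_X x hx
  have hflux : flux 1 u 1 = 3 * f (q 1) - ∑' w, 6 / 7 * muWord w * f (p w) := by
    rw [h.flux_eq_tsum, hu.boundary _ (Or.inl rfl)]
    simp only [hX _ (p_mem_X _)]
  refine ⟨isProbabilityMeasure_mu, mu_compl_X, (integrable_mu hbound).integrableOn,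
    summable_of_bound hbound _, flux 1 u 1, h.hasNormalDeriv, hflux, ?_,
    fun _ => h.hasEnergyOmega⟩
  rw [restrict_mu, integral_mu hbound, hflux, ← tsum_mul_left]
  congr 2
  funext w
  ring
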